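/- For complex $a,q$ with $|q|<1$ let $(a;q)_\infty=\prod_{j\ge 0}(1-aq^j)$ and $(a,b;q)_\infty=(a;q)_\infty(b;q)_\infty$. Let $q,z\in\mathbb C$ with $|q|<1$, $z\neq 0$, and $zq^n\ne 1$, $z^{-1}q^n\neq 1$ for all integers $n\ge 1$. Define $$S_X(z,q)=\sum_{n=1}^\infty \frac{c_X(n)}{(zq^n,z^{-1}q^n;q)_\infty},$$ where $$\begin{aligned} c_{A1}(n)&=q^n(q^{2n+1};q)_\infty, & c_{A3}(n)&=q^{2n}(q^{2n+1};q)_\infty,\\ c_{A5}(n)&=q^{n^2+n}(q^{2n+1};q)_\infty, & c_{A7}(n)&=q^{n^2}(q^{2n+1};q)_\infty,\\ c_{C1}(n)&=q^n(q^{2n+1};q^2)_\infty(q^{n+1};q)_\infty, & c_{C5}(n)&=q^{(n^2+n)/2}(q^{2n+1};q^2)_\infty(q^{n+1};q)_\infty,\\ c_{E2}(n)&=(-1)^nq^n(q^{2n+2};q^2)_\infty, & c_{E4}(n)&=q^{2n}(q^{2n+2};q^2)_\infty. \end{aligned}$$ Then these series and all series below converge absolutely (the double series over $k,n$ for $A3$,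 $C1$, $E4$ as families indexed by pairs $(k,n)$), and $$(1+z)(z,z^{-1};q)_\infty S_{A1}(z,q)=\frac{1}{(q;q)_\infty}\sum_{k=1}^\infty(1-z^{k-1})(1-z^k)z^{1-k}\Big((-1)^{k+1}q^{\frac{k(k-1)}2}+\sum_{n=1}^\infty(-1)^{n+k+1}q^{\frac{k(k-1)}2+\frac{n(n-3)}2+2kn}(1+q^n)\Big),$$ $$(1+z)(z,z^{-1};q)_\infty S_{A3}(z,q)=\frac{1}{(q;q)_\infty}\sum_{k=1}^\infty\sum_{n=0}^\infty(1-z^{k-1})(1-z^k)z^{1-k}(-1)^{n+k+1}q^{\frac{k(k+1)}2+\frac{n(n-3)}2+2kn-1}(1-q^{2n+1}),$$ $$(1+z)(z,z^{-1};q)_\infty S_{A5}(z,q)=\sum_{k=-\infty}^\infty(-1)^k(1-z^k)(1-z^{k+1})z^{-k}q^{\frac{k(3k+1)}2},$$ $$(1+z)(z,z^{-1};q)_\infty S_{A7}(z,q)=\sum_{k=-\infty}^\infty(-1)^k(1-z^k)(1-z^{k+1})z^{-k}q^{\frac{k(3k-1)}2},$$ $$(1+z)(z,z^{-1};q)_\infty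 S_{C1}(z,q)=\frac{1}{(q;q)_\infty}\sum_{k=1}^\infty\sum_{n=0}^\infty(1-z^{k-1})(1-z^k)z^{1-k}(-1)^{k+1}q^{\frac{k(k-1)}2+\frac{n(3n-1)}2+3kn}(1-q^{2k-1})(1-q^{k+n}),$$ $$(1+z)(z,z^{-1};q)_\infty S_{C5}(z,q)=\sum_{k=-\infty}^\infty(1-z^{k-1})(1-z^k)z^{1-k}(-1)^kq^{k^2},$$ $$(1+z)(z,z^{-1};q)_\infty S_{E2}(z,q)=(q;q^2)_\infty\sum_{k=1}^\infty(1-z^k)(1-z^{k-1})z^{1-k}q^{\frac{k(k-1)}2},$$ $$(1+z)(z,z^{-1};q)_\infty S_{E4}(z,q)=\frac{1}{(q;q)_\infty}\sum_{k=1}^\infty\sum_{n=0}^\infty(1-z^{k-1})(1-z^k)z^{1-k}(-1)^{k+n+1}q^{\frac{k(k+1)}2+n^2-n+2kn-1}(1-q^{2n+1}).$$ -/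

import Mathlib

noncomputable section

/-- The infinite `q`-shifted factorial `(a; q)_∞ = ∏_{j ≥ 0} (1 - a q ^ j)`. It is used for
`‖q‖ < 1` only, where the product converges (`multipliable_qPochInf`). -/
def qPochInf (a q : ℂ) : ℂ := ∏' j : ℕ, (1 - a * q ^ j)

theorem multipliable_qPochInf (a : ℂ) {q : ℂ} (hq : ‖q‖ < 1) :
    Multipliable fun j : ℕ => 1 - a * q ^ j := by
  have h : Multipliable fun j : ℕ => 1 + -(a * q ^ j) := by
    apply multipliable_one_add_of_summable
    simpa using (summable_geometric_of_lt_one (norm_nonneg q) hq).mul_left ‖a‖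
  simpa [sub_eq_add_neg] using h

/-- The `n`-th term `c n / ((z q ^ n; q)_∞ (z⁻¹ q ^ n; q)_∞)` of an spt-crank-type series with
numerators `c`. -/
def sptCrankTerm (c : ℕ → ℂ) (z q : ℂ) (n : ℕ) : ℂ :=
  c n / (qPochInf (z * q ^ n) q * qPochInf (z⁻¹ * q ^ n) q)

/-- The spt-crank-type series `∑_{n ≥ 1} c n / ((z q ^ n; q)_∞ (z⁻¹ q ^ n; q)_∞)`. -/
def sptCrankSeries (c : ℕ → ℂ) (z q : ℂ) : ℂ := ∑' n : ℕ+, sptCrankTerm c z q n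

/-- `q ^ n (q ^ (2n+1); q)_∞`. -/
def numA1 (q : ℂ) (n : ℕ) : ℂ := q ^ n * qPochInf (q ^ (2 * n + 1)) q

/-- `q ^ (2n) (q ^ (2n+1); q)_∞`. -/
def numA3 (q : ℂ) (n : ℕ) : ℂ := q ^ (2 * n) * qPochInf (q ^ (2 * n + 1)) q

/-- `q ^ (n²+n) (q ^ (2n+1); q)_∞`. -/
def numA5 (q : ℂ) (n : ℕ) : ℂ := q ^ (n ^ 2 + n) * qPochInf (q ^ (2 * n + 1)) q

/-- `q ^ (n²) (q ^ (2n+1); q)_∞`. -/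
def numA7 (q : ℂ) (n : ℕ) : ℂ := q ^ (n ^ 2) * qPochInf (q ^ (2 * n + 1)) q

/-- `q ^ n (q ^ (2n+1); q²)_∞ (q ^ (n+1); q)_∞`. -/
def numC1 (q : ℂ) (n : ℕ) : ℂ :=
  q ^ n * qPochInf (q ^ (2 * n + 1)) (q ^ 2) * qPochInf (q ^ (n + 1)) q

/-- `q ^ ((n²+n)/2) (q ^ (2n+1); q²)_∞ (q ^ (n+1); q)_∞`; the exponent is a natural number. -/
def numC5 (q : ℂ) (n : ℕ) : ℂ :=
  q ^ ((n ^ 2 + n) / 2) * qPochInf (q ^ (2 * n + 1)) (q ^ 2) * qPochInf (q ^ (n + 1)) q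

/-- `(-1) ^ n q ^ n (q ^ (2n+2); q²)_∞`. -/
def numE2 (q : ℂ) (n : ℕ) : ℂ := (-1) ^ n * q ^ n * qPochInf (q ^ (2 * n + 2)) (q ^ 2)

/-- `q ^ (2n) (q ^ (2n+2); q²)_∞`. -/
def numE4 (q : ℂ) (n : ℕ) : ℂ := q ^ (2 * n) * qPochInf (q ^ (2 * n + 2)) (q ^ 2)

/-- `S_A1(z, q)`; similarly below for the other labels. -/
def sptA1 (z q : ℂ) : ℂ := sptCrankSeries (numA1 q) z q
def sptA3 (z q : ℂ) : ℂ := sptCrankSeries (numA3 q) z q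
def sptA5 (z q : ℂ) : ℂ := sptCrankSeries (numA5 q) z q
def sptA7 (z q : ℂ) : ℂ := sptCrankSeries (numA7 q) z q
def sptC1 (z q : ℂ) : ℂ := sptCrankSeries (numC1 q) z q
def sptC5 (z q : ℂ) : ℂ := sptCrankSeries (numC5 q) z q
def sptE2 (z q : ℂ) : ℂ := sptCrankSeries (numE2 q) z q
def sptE4 (z q : ℂ) : ℂ := sptCrankSeries (numE4 q) z q

/-- The prefactor `(1 + z) (z, z⁻¹; q)_∞`. -/
def sptPrefactor (z q : ℂ) : ℂ := (1 + z) * (qPochInf z q * qPochInf z⁻¹ q)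

/-- The Laurent polynomial `(1 - z ^ (k-1)) (1 - z ^ k) z ^ (1-k)`. -/
def zFactor (z : ℂ) (k : ℤ) : ℂ := (1 - z ^ (k - 1)) * (1 - z ^ k) * z ^ (1 - k)

end

/-! Since `(a; q)_∞ = (a; q)_n (a q^n; q)_∞`, the prefactor turns the `n`-th summand into `c n`
times the Laurent polynomial `(1 + z) (z; q)_n (z⁻¹; q)_n`. This polynomial has an explicit
expansion in the functions `z^(i+1) + z^(-i)`. For `n ≥ 1` it vanishes at `z = 1`, so the
coefficients sum to zero and each of these functions may be replaced by `zFactor z (i+1) = z^(i+1) +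
z^(-i) - (1 + z)`. The factor `q^(i(i-1)/2)` in the coefficients makes the double sum over `(n, i)`
absolutely convergent. Interchanging the sums (`hasSum_sptPrefactor_mul`) gives `zFactor z (i+1)`
the coefficient `(-1)^i q^(i(i-1)/2) (1 - q^(2i+1)) ∑_m d (m+i) / ((q; q)_m (q; q)_(m+2i+1))`, where
`d n = c n (q; q)_(2n)`.

This is a Bailey-type argument in which only the inner sum over `m` depends on the series. Up to
constants and signs, `d n` is a power of `q` times `1` (A), `(-q; q)_n` (C) or `(q; q²)_n` (E). For
A5 and A7 the inner sum is a Durfee rectangle series (`tsum_durfee`). In the other cases Heine's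
transformation (`heine_symm`) applies: it leads directly to partial theta series (A1, A3), to a sum
evaluated by the `q`-binomial theorem (C5, E2), or to a Rogers–Fine type sum (C1, E4). The latter is
identified with partial theta series by showing that both sides satisfy the same contracting
recurrence under `y ↦ y q` (`eq_zero_of_eq_mul_succ`). Expanding the partial theta series gives the
double series; folding a bilateral series by `k ↦ 1 - k` gives A5, A7 and C5. -/

noncomputable section

open Finset Filter Topology

/-- The finite `q`-shifted factorial `(a; q)_n`. -/
def qPoch (a q : ℂ) (n : ℕ) : ℂ := ∏ j ∈ range n, (1 - a * q ^ j)

/-- The coefficients `∏_{j < n} (b - a q ^ j) / (q; q)_n` of the homogeneous `q`-binomial series. -/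
def qBinCoeff (b a q : ℂ) (n : ℕ) : ℂ := (∏ j ∈ range n, (b - a * q ^ j)) / qPoch q q n

/-! ### Finite and infinite `q`-shifted factorials. -/

section Pochhammer

variable {q : ℂ}

@[simp] theorem qPoch_zero (a q : ℂ) : qPoch a q 0 = 1 := by simp [qPoch]

theorem qPoch_succ (a q : ℂ) (n : ℕ) : qPoch a q (n + 1) = qPoch a q n * (1 - a * q ^ n) := by
  simp [qPoch, prod_range_succ]

theorem qPoch_self_succ (q : ℂ) (n : ℕ) :
    qPoch q q (n + 1) = qPoch q q n * (1 - q ^ (n + 1)) := by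
  rw [qPoch_succ, pow_succ']

theorem qPoch_succ' (a q : ℂ) (n : ℕ) : qPoch a q (n + 1) = (1 - a) * qPoch (a * q) q n := by
  simp only [qPoch, prod_range_succ', pow_zero, mul_one]
  rw [mul_comm]
  congr 1
  refine prod_congr rfl fun j _ => ?_
  ring

theorem qPoch_add (a q : ℂ) (m n : ℕ) :
    qPoch a q (m + n) = qPoch a q m * qPoch (a * q ^ m) q n := by
  simp only [qPoch, prod_range_add]
  congr 1
  refine prod_congr rfl fun j _ => ?_
  ring

theorem qPochInf_eq_mul (hq : ‖q‖ < 1) (a : ℂ) (n : ℕ) :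
    qPochInf a q = qPoch a q n * qPochInf (a * q ^ n) q := by
  have e : (fun j : ℕ => 1 - a * q ^ n * q ^ j) = fun j : ℕ => 1 - a * q ^ (j + n) := by
    funext j
    rw [mul_assoc, ← pow_add, add_comm n j]
  have h : Multipliable fun j : ℕ => 1 - a * q ^ (j + n) := e ▸ multipliable_qPochInf (a * q ^ n) hq
  have h2 := Multipliable.prod_mul_tprod_nat_mul' (f := fun j : ℕ => 1 - a * q ^ j) h
  simp only [qPochInf, qPoch, e]
  exact h2.symm

theorem qPochInf_eq_one_sub_mul (hq : ‖q‖ < 1) (a : ℂ) :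
    qPochInf a q = (1 - a) * qPochInf (a * q) q := by
  simpa [qPoch] using qPochInf_eq_mul hq a 1

theorem qPochInf_zero (q : ℂ) : qPochInf 0 q = 1 := by simp [qPochInf]

theorem tendsto_qPoch (hq : ‖q‖ < 1) (a : ℂ) :
    Tendsto (qPoch a q) atTop (𝓝 (qPochInf a q)) :=
  (multipliable_qPochInf a hq).tendsto_prod_tprod_nat

theorem qPochInf_ne_zero (hq : ‖q‖ < 1) {a : ℂ} (h : ∀ j : ℕ, a * q ^ j ≠ 1) :
    qPochInf a q ≠ 0 := by
  have := tprod_one_add_ne_zero_of_summable (f := fun j : ℕ => -(a * q ^ j)) (fun j => by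
    have := sub_ne_zero.2 (h j).symm
    simpa [← sub_eq_add_neg] using this)
    (by simpa using (summable_geometric_of_lt_one (norm_nonneg q) hq).mul_left ‖a‖)
  simpa [qPochInf, sub_eq_add_neg] using this

theorem mul_pow_ne_one (hq : ‖q‖ < 1) {a : ℂ} (ha : ‖a‖ < 1) (j : ℕ) : a * q ^ j ≠ 1 := by
  intro h
  have h1 : ‖a * q ^ j‖ = 1 := by rw [h, norm_one]
  have h2 : ‖q‖ ^ j ≤ 1 := pow_le_one₀ (norm_nonneg _) hq.le
  rw [norm_mul, norm_pow] at h1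
  nlinarith [norm_nonneg a]

theorem qPochInf_ne_zero_of_norm_lt (hq : ‖q‖ < 1) {a : ℂ} (ha : ‖a‖ < 1) :
    qPochInf a q ≠ 0 :=
  qPochInf_ne_zero hq (mul_pow_ne_one hq ha)

theorem qPoch_ne_zero_of_norm_lt (hq : ‖q‖ < 1) {a : ℂ} (ha : ‖a‖ < 1) (n : ℕ) :
    qPoch a q n ≠ 0 :=
  prod_ne_zero_iff.2 fun j _ => sub_ne_zero.2 (mul_pow_ne_one hq ha j).symm

theorem one_sub_pow_ne_zero (hq : ‖q‖ < 1) (n : ℕ) : 1 - q ^ (n + 1) ≠ 0 := by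
  rw [pow_succ']
  exact sub_ne_zero.2 (mul_pow_ne_one hq hq n).symm

theorem exists_norm_qPoch_le (hq : ‖q‖ < 1) (a : ℂ) : ∃ C, ∀ n, ‖qPoch a q n‖ ≤ C := by
  obtain ⟨C, hC⟩ := (tendsto_qPoch hq a).norm.bddAbove_range
  exact ⟨C, fun n => hC ⟨n, rfl⟩⟩

theorem exists_norm_inv_qPoch_le (hq : ‖q‖ < 1) {a : ℂ} (ha : ‖a‖ < 1) :
    ∃ C, ∀ n, ‖(qPoch a q n)⁻¹‖ ≤ C := by
  obtain ⟨C, hC⟩ :=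
    ((tendsto_qPoch hq a).inv₀ (qPochInf_ne_zero_of_norm_lt hq ha)).norm.bddAbove_range
  exact ⟨C, fun n => hC ⟨n, rfl⟩⟩

theorem qPochInf_mul_neg (hq : ‖q‖ < 1) (a : ℂ) :
    qPochInf a q * qPochInf (-a) q = qPochInf (a ^ 2) (q ^ 2) := by
  rw [qPochInf, qPochInf, qPochInf,
    ← (multipliable_qPochInf a hq).tprod_mul (multipliable_qPochInf (-a) hq)]
  refine tprod_congr fun j => ?_
  ring

theorem norm_sq_lt_one (hq : ‖q‖ < 1) : ‖q ^ 2‖ < 1 := by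
  rw [norm_pow]
  exact pow_lt_one₀ (norm_nonneg _) hq two_ne_zero

theorem qPoch_two_mul (a q : ℂ) (n : ℕ) :
    qPoch a q (2 * n) = qPoch a (q ^ 2) n * qPoch (a * q) (q ^ 2) n := by
  induction n with
  | zero => simp
  | succ n ih =>
    rw [show 2 * (n + 1) = 2 * n + 1 + 1 by ring, qPoch_succ, qPoch_succ, ih, qPoch_succ,
      qPoch_succ]
    ring

/-- Even and odd factors: `(a; q)_∞ = (a; q²)_∞ (a q; q²)_∞`. -/
theorem qPochInf_eq_even_mul_odd (hq : ‖q‖ < 1) (a : ℂ) :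
    qPochInf a q = qPochInf a (q ^ 2) * qPochInf (a * q) (q ^ 2) := by
  have h2 := norm_sq_lt_one hq
  have h1 : Tendsto (fun n => qPoch a q (2 * n)) atTop (𝓝 (qPochInf a q)) :=
    (tendsto_qPoch hq a).comp (tendsto_id.const_mul_atTop' two_pos)
  refine tendsto_nhds_unique h1 ?_
  simp only [qPoch_two_mul]
  exact (tendsto_qPoch h2 a).mul (tendsto_qPoch h2 (a * q))

/-- Euler's identity `(-q; q)_∞ (q; q²)_∞ = 1`. -/
theorem qPochInf_neg_mul_odd (hq : ‖q‖ < 1) :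
    qPochInf (-q) q * qPochInf q (q ^ 2) = 1 := by
  have h1 := qPochInf_mul_neg hq q
  have h2 := qPochInf_eq_even_mul_odd hq q
  have h0 := qPochInf_ne_zero_of_norm_lt (norm_sq_lt_one hq) (norm_sq_lt_one hq)
  -- Both `(q; q)_∞ (-q; q)_∞` and, after splitting `(q; q)_∞` by parity, the product in question
  -- carry the factor `(q²; q²)_∞`, which cancels.
  rw [← pow_two] at h2
  rw [h2] at h1
  refine mul_right_cancel₀ h0 ?_
  linear_combination h1

end Pochhammer

/-! ### The `q`-binomial theorem and Heine's transformation. -/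

section Binomial

variable {q : ℂ}

@[simp] theorem qBinCoeff_zero (b a q : ℂ) : qBinCoeff b a q 0 = 1 := by simp [qBinCoeff]

theorem qBinCoeff_succ (hq : ‖q‖ < 1) (b a : ℂ) (n : ℕ) :
    qBinCoeff b a q (n + 1) * (1 - q ^ (n + 1)) = qBinCoeff b a q n * (b - a * q ^ n) := by
  have h1 := one_sub_pow_ne_zero hq n
  have h2 := qPoch_ne_zero_of_norm_lt hq hq n
  rw [qBinCoeff, qBinCoeff, qPoch_self_succ, prod_range_succ]
  field_simp

theorem qBinCoeff_mul_pow (b a q x : ℂ) (n : ℕ) :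
    qBinCoeff (b * x) (a * x) q n = qBinCoeff b a q n * x ^ n := by
  have : ∏ j ∈ range n, (b * x - a * x * q ^ j) = (∏ j ∈ range n, (b - a * q ^ j)) * x ^ n := by
    rw [← card_range n, ← prod_const, card_range, ← prod_mul_distrib]
    refine prod_congr rfl fun j _ => ?_
    ring
  rw [qBinCoeff, qBinCoeff, this]
  ring

theorem summable_norm_qBinCoeff (hq : ‖q‖ < 1) {b : ℂ} (hb : ‖b‖ < 1) (a : ℂ) :
    Summable fun n => ‖qBinCoeff b a q n‖ := by
  obtain ⟨r, hr, hr1⟩ := exists_between hb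
  have hpow := tendsto_pow_atTop_nhds_zero_of_norm_lt_one hq
  have hlim : Tendsto (fun n : ℕ => ‖(b - a * q ^ n) / (1 - q ^ (n + 1))‖) atTop (𝓝 ‖b‖) := by
    have h1 := ((hpow.const_mul a).const_sub b).div
      ((hpow.comp (tendsto_add_atTop_nat 1)).const_sub 1) (by simp)
    simpa using h1.norm
  refine summable_of_ratio_norm_eventually_le (r := r) hr1 ?_
  filter_upwards [hlim.eventually_le_const hr] with n hn
  have h : qBinCoeff b a q (n + 1)
      = qBinCoeff b a q n * ((b - a * q ^ n) / (1 - q ^ (n + 1))) := by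
    rw [← mul_div_assoc, eq_div_iff (one_sub_pow_ne_zero hq n), qBinCoeff_succ hq]
  rw [norm_norm, norm_norm, h, norm_mul, mul_comm]
  exact mul_le_mul_of_nonneg_right hn (norm_nonneg _)

theorem norm_mul_pow_lt_one (hq : ‖q‖ < 1) {b : ℂ} (hb : ‖b‖ < 1) (n : ℕ) : ‖b * q ^ n‖ < 1 := by
  rw [norm_mul, norm_pow]
  exact mul_lt_one_of_nonneg_of_lt_one_left (norm_nonneg _) hb
    (pow_le_one₀ (norm_nonneg _) hq.le)

/-- The `q`-binomial theorem, in homogeneous form. -/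
theorem tsum_qBinCoeff (hq : ‖q‖ < 1) {b : ℂ} (hb : ‖b‖ < 1) (a : ℂ) :
    ∑' n, qBinCoeff b a q n = qPochInf a q / qPochInf b q := by
  -- Functional equation of the sum `F(b, a)`: `(1 - b) F(b, a) = (1 - a) F(b q, a q)`, by summing
  -- the coefficient recurrence. Iterating it produces the two products, and `F(b q^n, a q^n) → 1`
  -- by dominated convergence.
  have hrec : ∀ b a : ℂ, ‖b‖ < 1 →
      (1 - b) * ∑' n, qBinCoeff b a q n
        = (1 - a) * ∑' n, qBinCoeff (b * q) (a * q) q n := by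
    intro b a hb
    have hs := (summable_norm_qBinCoeff hq hb a).of_norm
    have hbq : ‖b * q‖ < 1 := by simpa using norm_mul_pow_lt_one hq hb 1
    have hsq := (summable_norm_qBinCoeff hq hbq (a * q)).of_norm
    have h1 : ∑' n, (qBinCoeff b a q n - qBinCoeff (b * q) (a * q) q n)
        = ∑' n, (b * qBinCoeff b a q n - a * qBinCoeff (b * q) (a * q) q n) := by
      rw [(hs.sub hsq).tsum_eq_zero_add]
      simp only [qBinCoeff_zero, sub_self, zero_add]
      refine tsum_congr fun n => ?_
      rw [qBinCoeff_mul_pow, qBinCoeff_mul_pow]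
      linear_combination qBinCoeff_succ hq b a n
    rw [hs.tsum_sub hsq, (hs.mul_left b).tsum_sub (hsq.mul_left a), tsum_mul_left,
      tsum_mul_left] at h1
    linear_combination h1
  have hiter : ∀ n, qPoch b q n * ∑' m, qBinCoeff b a q m
      = qPoch a q n * ∑' m, qBinCoeff (b * q ^ n) (a * q ^ n) q m := by
    intro n
    induction n with
    | zero => simp
    | succ n ih =>
      rw [qPoch_succ, qPoch_succ, pow_succ, ← mul_assoc, ← mul_assoc]
      linear_combination (1 - b * q ^ n) * ih
        + qPoch a q n * hrec (b * q ^ n) (a * q ^ n) (norm_mul_pow_lt_one hq hb n)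
  have hlim : Tendsto (fun n => ∑' m, qBinCoeff (b * q ^ n) (a * q ^ n) q m) atTop
      (𝓝 (∑' m, if m = 0 then 1 else 0)) := by
    refine tendsto_tsum_of_dominated_convergence (summable_norm_qBinCoeff hq hb a)
      (fun m => ?_) (Eventually.of_forall fun n m => ?_)
    · rcases m with _ | m
      · simp
      · simp only [qBinCoeff_mul_pow, Nat.succ_ne_zero, if_false]
        have h := ((tendsto_pow_atTop_nhds_zero_of_norm_lt_one hq).pow (m + 1)).const_mul
          (qBinCoeff b a q (m + 1))
        simpa using h
    · rw [qBinCoeff_mul_pow, norm_mul]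
      refine mul_le_of_le_one_right (norm_nonneg _) ?_
      rw [norm_pow, norm_pow]
      exact pow_le_one₀ (by positivity) (pow_le_one₀ (norm_nonneg _) hq.le)
  rw [tsum_ite_eq] at hlim
  rw [eq_div_iff (qPochInf_ne_zero_of_norm_lt hq hb), mul_comm]
  refine tendsto_nhds_unique ((tendsto_qPoch hq b).mul_const _) ?_
  simp only [hiter]
  simpa using (tendsto_qPoch hq a).mul hlim

theorem tsum_qBinCoeff_mul_pow (hq : ‖q‖ < 1) {b : ℂ} (hb : ‖b‖ < 1) (a : ℂ) (m : ℕ) :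
    ∑' n, qBinCoeff b a q n * q ^ (m * n)
      = qPochInf (a * q ^ m) q / qPochInf (b * q ^ m) q := by
  rw [← tsum_qBinCoeff hq (norm_mul_pow_lt_one hq hb m)]
  refine tsum_congr fun n => ?_
  rw [qBinCoeff_mul_pow, pow_mul]

/-- A symmetric form of Heine's transformation. -/
theorem heine_symm (hq : ‖q‖ < 1) {b b' : ℂ} (hb : ‖b‖ < 1) (hb' : ‖b'‖ < 1) (a a' : ℂ) :
    ∑' m, qBinCoeff b a q m * (qPochInf (a' * q ^ m) q / qPochInf (b' * q ^ m) q)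
      = ∑' r, qBinCoeff b' a' q r * (qPochInf (a * q ^ r) q / qPochInf (b * q ^ r) q) := by
  -- Expanding either quotient of products by the `q`-binomial theorem gives the same double series,
  -- with kernel `q^(m r)` symmetric in `m` and `r`; only the order of summation differs.
  have hs : Summable (Function.uncurry fun m r : ℕ =>
      qBinCoeff b a q m * (qBinCoeff b' a' q r * q ^ (m * r))) := by
    refine Summable.of_norm_bounded
      (g := fun p : ℕ × ℕ => ‖qBinCoeff b a q p.1‖ * ‖qBinCoeff b' a' q p.2‖)
      ((summable_norm_qBinCoeff hq hb a).mul_of_nonneg (summable_norm_qBinCoeff hq hb' a')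
        (fun _ => norm_nonneg _) (fun _ => norm_nonneg _)) ?_
    rintro ⟨m, r⟩
    simp only [Function.uncurry_apply_pair, norm_mul]
    refine mul_le_mul_of_nonneg_left (mul_le_of_le_one_right (norm_nonneg _) ?_) (norm_nonneg _)
    rw [norm_pow]
    exact pow_le_one₀ (norm_nonneg _) hq.le
  have h := hs.tsum_comm
  calc _ = ∑' m, ∑' r, qBinCoeff b a q m * (qBinCoeff b' a' q r * q ^ (m * r)) := by
        refine tsum_congr fun m => ?_
        rw [tsum_mul_left, tsum_qBinCoeff_mul_pow hq hb']
    _ = ∑' r, ∑' m, qBinCoeff b a q m * (qBinCoeff b' a' q r * q ^ (m * r)) := h.symm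
    _ = _ := by
        refine tsum_congr fun r => ?_
        rw [← tsum_qBinCoeff_mul_pow hq hb, ← tsum_mul_left]
        refine tsum_congr fun m => ?_
        rw [mul_comm m r]
        ring

end Binomial

/-- A bounded solution of a homogeneous recurrence with contracting coefficients vanishes. -/
theorem eq_zero_of_eq_mul_succ {δ c : ℕ → ℂ} {ρ C : ℝ} (hρ0 : 0 ≤ ρ) (hρ : ρ < 1)
    (h : ∀ n, δ n = c n * δ (n + 1)) (hc : ∀ n, ‖c n‖ ≤ ρ) (hC : ∀ n, ‖δ n‖ ≤ C) (n : ℕ) :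
    δ n = 0 := by
  have hk : ∀ k n, ‖δ n‖ ≤ ρ ^ k * C := by
    intro k
    induction k with
    | zero => simpa using hC
    | succ k ih =>
      intro n
      rw [h n, norm_mul, pow_succ', mul_assoc]
      exact mul_le_mul (hc n) (ih _) (norm_nonneg _) hρ0
  have hlim : Tendsto (fun k : ℕ => ρ ^ k * C) atTop (𝓝 0) := by
    simpa using (tendsto_pow_atTop_nhds_zero_of_lt_one hρ0 hρ).mul_const C
  exact norm_le_zero_iff.1 (ge_of_tendsto' hlim fun k => hk k n)

/-- Coefficients of the Laurent polynomial `(1 + z) (z; q)_n (z⁻¹; q)_n / (q; q)_{2n}`. -/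
def crankCoeff (q : ℂ) (n i : ℕ) : ℂ :=
  if i ≤ n then (-1) ^ i * q ^ i.choose 2 * (1 - q ^ (2 * i + 1)) /
    (qPoch q q (n + i + 1) * qPoch q q (n - i)) else 0

/-! ### The Laurent expansion of `(1 + z) (z; q)_n (z⁻¹; q)_n`. -/

section FiniteIdentity

variable {q : ℂ}

theorem crankCoeff_of_lt (q : ℂ) {n i : ℕ} (h : n < i) : crankCoeff q n i = 0 :=
  if_neg h.not_ge

theorem crankCoeff_add (q : ℂ) (i d : ℕ) : crankCoeff q (i + d) i =
    (-1) ^ i * q ^ i.choose 2 * (1 - q ^ (2 * i + 1)) /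
      (qPoch q q (2 * i + d + 1) * qPoch q q d) := by
  rw [crankCoeff, if_pos (Nat.le_add_right i d), Nat.add_sub_cancel_left]
  congr 4
  ring

theorem pow_choose_two_succ (q : ℂ) (i : ℕ) : q ^ (i + 1).choose 2 = q ^ i.choose 2 * q ^ i := by
  rw [Nat.choose_succ_succ', Nat.choose_one_right, pow_add, mul_comm]

/-- Going from `n` to `n + 1` multiplies the Laurent polynomial by `(1 - z q^n) (1 - z⁻¹ q^n) = 1 +
q^(2n) - q^n (z + z⁻¹)`. Here the coefficients of `z + 1` are compared: it receives contributions
from index `1` and, by reflection, from index `0` itself. -/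
theorem crankCoeff_succ_zero (hq : ‖q‖ < 1) (n : ℕ) :
    (1 - q ^ (2 * n + 1)) * (1 - q ^ (2 * n + 2)) * crankCoeff q (n + 1) 0
      = (1 + q ^ (2 * n)) * crankCoeff q n 0 - q ^ n * (crankCoeff q n 0 + crankCoeff q n 1) := by
  have h := one_sub_pow_ne_zero hq
  have hP := qPoch_ne_zero_of_norm_lt hq hq
  rcases n with _ | n
  · have h0 := h 0
    have h1 := h 1
    simp [crankCoeff, qPoch_self_succ] at *
    field_simp
    ring
  · have e1 := crankCoeff_add q 0 (n + 2)
    have e2 := crankCoeff_add q 0 (n + 1)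
    have e3 := crankCoeff_add q 1 n
    rw [zero_add] at e1 e2
    rw [add_comm 1 n] at e3
    rw [show n + 1 + 1 = n + 2 by ring, e1, e2, e3]
    rw [show 2 * 0 + (n + 2) + 1 = n + 3 by ring, show 2 * 0 + (n + 1) + 1 = n + 2 by ring,
      show 2 * 1 + n + 1 = n + 3 by ring, qPoch_self_succ q (n + 2), qPoch_self_succ q (n + 1),
      qPoch_self_succ q n]
    have h0 := h n
    have h1 := h (n + 1)
    have h2 := h (n + 2)
    have h3 := hP n
    have e : Nat.choose 1 2 = 0 := rfl
    simp only [Nat.choose_zero_succ, e, pow_zero]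
    field_simp
    ring

/-- The same comparison away from the reflecting boundary. The cases `n < j`, `n = j`, `n = j + 1`
and `n ≥ j + 2` differ in which coefficients are truncated to zero. -/
theorem crankCoeff_succ_succ (hq : ‖q‖ < 1) (n j : ℕ) :
    (1 - q ^ (2 * n + 1)) * (1 - q ^ (2 * n + 2)) * crankCoeff q (n + 1) (j + 1)
      = (1 + q ^ (2 * n)) * crankCoeff q n (j + 1)
        - q ^ n * (crankCoeff q n j + crankCoeff q n (j + 2)) := by
  have h := one_sub_pow_ne_zero hq
  have hP := qPoch_ne_zero_of_norm_lt hq hq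
  rcases lt_trichotomy n j with hlt | rfl | hgt
  · rw [crankCoeff_of_lt q (by omega), crankCoeff_of_lt q (by omega),
      crankCoeff_of_lt q hlt, crankCoeff_of_lt q (by omega)]
    ring
  · have e1 := crankCoeff_add q (n + 1) 0
    have e2 := crankCoeff_add q n 0
    rw [add_zero] at e1 e2
    rw [e1, e2, crankCoeff_of_lt q (by omega), crankCoeff_of_lt q (by omega),
      show 2 * (n + 1) + 0 + 1 = 2 * n + 3 by ring, qPoch_self_succ q (2 * n + 2),
      qPoch_self_succ q (2 * n + 1), pow_choose_two_succ, show 2 * n + 0 + 1 = 2 * n + 1 by ring]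
    have h0 := h (2 * n + 1)
    have h1 := h (2 * n + 2)
    have h2 := hP (2 * n + 1)
    rw [qPoch_zero]
    field_simp
    ring
  · obtain ⟨d, rfl⟩ := Nat.exists_eq_add_of_lt hgt
    rcases d with _ | d
    · have e1 := crankCoeff_add q (j + 1) 1
      have e2 := crankCoeff_add q (j + 1) 0
      have e3 := crankCoeff_add q j 1
      rw [add_zero] at e2
      rw [add_zero, e1, e2, e3, crankCoeff_of_lt q (by omega),
        show 2 * (j + 1) + 1 + 1 = 2 * j + 4 by ring, show 2 * (j + 1) + 0 + 1 = 2 * j + 3 by ring,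
        show 2 * j + 1 + 1 = 2 * j + 2 by ring, qPoch_self_succ q (2 * j + 3),
        qPoch_self_succ q (2 * j + 2), pow_choose_two_succ, qPoch_self_succ q 0, qPoch_zero]
      have h0 := h 0
      have h1 := h (2 * j + 2)
      have h2 := h (2 * j + 3)
      have h3 := hP (2 * j + 2)
      field_simp
      ring
    · have e1 := crankCoeff_add q (j + 1) (d + 2)
      have e2 := crankCoeff_add q (j + 1) (d + 1)
      have e3 := crankCoeff_add q j (d + 2)
      have e4 := crankCoeff_add q (j + 2) d
      rw [show j + 1 + (d + 2) = j + (d + 1) + 1 + 1 by ring,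
        show 2 * (j + 1) + (d + 2) + 1 = 2 * j + d + 5 by ring] at e1
      rw [show j + 1 + (d + 1) = j + (d + 1) + 1 by ring,
        show 2 * (j + 1) + (d + 1) + 1 = 2 * j + d + 4 by ring] at e2
      rw [show j + (d + 2) = j + (d + 1) + 1 by ring,
        show 2 * j + (d + 2) + 1 = 2 * j + d + 3 by ring] at e3
      rw [show j + 2 + d = j + (d + 1) + 1 by ring,
        show 2 * (j + 2) + d + 1 = 2 * j + d + 5 by ring] at e4
      rw [e1, e2, e3, e4, qPoch_self_succ q (2 * j + d + 4), qPoch_self_succ q (2 * j + d + 3),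
        pow_choose_two_succ q (j + 1), pow_choose_two_succ q j, qPoch_self_succ q (d + 1), qPoch_self_succ q d]
      have h1 := h (2 * j + d + 3)
      have h2 := h (2 * j + d + 4)
      have h3 := hP (2 * j + d + 3)
      have h4 := hP d
      have h5 := h d
      have h6 := h (d + 1)
      field_simp
      ring

/-- The expansion of `(1 + z) (z; q)_n (z⁻¹; q)_n` in powers of `z`. -/
theorem one_add_mul_qPoch_mul_qPoch_inv (hq : ‖q‖ < 1) {z : ℂ} (hz : z ≠ 0) (n : ℕ) :
    (1 + z) * (qPoch z q n * qPoch z⁻¹ q n) = qPoch q q (2 * n) *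
      ∑ i ∈ range (n + 1), crankCoeff q n i * (z ^ (i + 1) + z⁻¹ ^ i) := by
  induction n with
  | zero =>
    have h := one_sub_pow_ne_zero hq 0
    simp [crankCoeff, qPoch_self_succ] at h ⊢
    rw [div_self h]
    ring
  | succ n ih =>
    have hzz : z * z⁻¹ = 1 := mul_inv_cancel₀ hz
    -- These functions are invariant under `i ↦ -1 - i`, so multiplication by `z + z⁻¹` moves the
    -- index by one in both directions and reflects `-1` to `0`.
    set e : ℕ → ℂ := fun i => z ^ (i + 1) + z⁻¹ ^ i with he
    have he0 : (z + z⁻¹) * e 0 = e 1 + e 0 := by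
      simp only [he]
      linear_combination hzz
    have hes : ∀ i, (z + z⁻¹) * e (i + 1) = e (i + 2) + e i := by
      intro i
      simp only [he]
      linear_combination (z ^ (i + 1) + z⁻¹ ^ i) * hzz
    have hsum : ∀ f : ℕ → ℂ, (∀ i, n < i → f i = 0) →
        (z + z⁻¹) * ∑ i ∈ range (n + 1), f i * e i
          = (f 0 + f 1) * e 0 + ∑ i ∈ range (n + 1), (f i + f (i + 2)) * e (i + 1) := by
      intro f hf
      have h1 : ∑ i ∈ range (n + 1), f (i + 2) * e (i + 1) + f 1 * e 0
          = ∑ i ∈ range n, f (i + 1) * e i := by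
        have := sum_range_succ' (fun i => f (i + 1) * e i) (n + 1)
        simp only [zero_add] at this
        rw [← this, sum_range_succ, sum_range_succ, hf (n + 1) (by omega),
          hf (n + 1 + 1) (by omega)]
        ring
      have h2 : (z + z⁻¹) * ∑ i ∈ range (n + 1), f i * e i
          = ∑ i ∈ range (n + 1), f i * e (i + 1) + (∑ i ∈ range n, f (i + 1) * e i + f 0 * e 0) := by
        rw [mul_sum, sum_range_succ', sum_range_succ' (fun i => f i * e (i + 1))]
        have : ∀ i, (z + z⁻¹) * (f (i + 1) * e (i + 1))
            = f (i + 1) * e (i + 1 + 1) + f (i + 1) * e i := fun i => by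
          linear_combination f (i + 1) * hes i
        simp only [this, sum_add_distrib]
        linear_combination f 0 * he0
      rw [h2, ← h1]
      simp only [add_mul, sum_add_distrib]
      ring
    have hs : (1 - q ^ (2 * n + 1)) * (1 - q ^ (2 * n + 2)) *
          ∑ i ∈ range (n + 1 + 1), crankCoeff q (n + 1) i * e i
        = (1 + q ^ (2 * n) - q ^ n * (z + z⁻¹)) * ∑ i ∈ range (n + 1), crankCoeff q n i * e i := by
      have h1 : ∑ i ∈ range (n + 1), crankCoeff q n i * e i
          = ∑ i ∈ range (n + 1), crankCoeff q n (i + 1) * e (i + 1) + crankCoeff q n 0 * e 0 := by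
        rw [← sum_range_succ' (fun i => crankCoeff q n i * e i), sum_range_succ _ (n + 1),
          crankCoeff_of_lt q (Nat.lt_succ_self n)]
        ring
      rw [sub_mul (1 + q ^ (2 * n)), mul_assoc (q ^ n), hsum _ fun i hi => crankCoeff_of_lt q hi, h1,
        sum_range_succ', mul_add, mul_add (1 + q ^ (2 * n)), mul_sum, mul_sum, mul_add (q ^ n),
        mul_sum]
      have h2 : ∀ i, (1 - q ^ (2 * n + 1)) * (1 - q ^ (2 * n + 2)) *
          (crankCoeff q (n + 1) (i + 1) * e (i + 1))
          = (1 + q ^ (2 * n)) * (crankCoeff q n (i + 1) * e (i + 1))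
            - q ^ n * ((crankCoeff q n i + crankCoeff q n (i + 2)) * e (i + 1)) := fun i => by
        linear_combination e (i + 1) * crankCoeff_succ_succ hq n i
      simp only [h2, sum_sub_distrib]
      linear_combination e 0 * crankCoeff_succ_zero hq n
    rw [qPoch_succ, qPoch_succ, show 2 * (n + 1) = 2 * n + 1 + 1 by ring, qPoch_self_succ,
      qPoch_self_succ, mul_assoc (qPoch q q (2 * n)), mul_assoc (qPoch q q (2 * n)),
      show 2 * n + 1 + 1 = 2 * n + 2 by ring, hs]
    linear_combination (1 + q ^ (2 * n) - q ^ n * (z + z⁻¹)) * ih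
      + (1 + z) * qPoch z q n * qPoch z⁻¹ q n * q ^ (2 * n) * hzz

end FiniteIdentity

/-! ### The interchange of summations. -/

section CrankSeries

variable {q z : ℂ}

theorem zFactor_natCast_add_one (hz : z ≠ 0) (i : ℕ) :
    zFactor z ((i : ℤ) + 1) = z ^ (i + 1) + z⁻¹ ^ i - (1 + z) := by
  have h : z ^ i * z⁻¹ ^ i = 1 := by rw [← mul_pow, mul_inv_cancel₀ hz, one_pow]
  have e1 : z ^ ((i : ℤ) + 1) = z ^ (i + 1) := by exact_mod_cast zpow_natCast z (i + 1)
  rw [zFactor, add_sub_cancel_right, show (1 : ℤ) - (i + 1) = -i by ring, zpow_neg, e1,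
    zpow_natCast, ← inv_pow]
  linear_combination (z ^ (i + 1) - z - 1) * h

theorem zFactor_one (z : ℂ) : zFactor z 1 = 0 := by simp [zFactor]

/-- At `z = 1` the factor `(1; q)_n` vanishes for `n ≥ 1`, so the coefficients sum to zero and
subtracting `1 + z` from every basis function changes nothing. -/
theorem one_add_mul_qPoch_eq_sum_zFactor (hq : ‖q‖ < 1) (hz : z ≠ 0) {n : ℕ} (hn : n ≠ 0) :
    (1 + z) * (qPoch z q n * qPoch z⁻¹ q n) = qPoch q q (2 * n) *
      ∑ i ∈ range (n + 1), crankCoeff q n i * zFactor z ((i : ℤ) + 1) := by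
  have h0 : ∑ i ∈ range (n + 1), crankCoeff q n i = 0 := by
    have h := one_add_mul_qPoch_mul_qPoch_inv hq one_ne_zero n
    obtain ⟨m, rfl⟩ := Nat.exists_eq_succ_of_ne_zero hn
    rw [Nat.succ_eq_add_one, qPoch_succ' 1] at h
    simp only [sub_self, zero_mul, mul_zero, one_pow, inv_one] at h
    rw [← sum_mul] at h
    have h2 := qPoch_ne_zero_of_norm_lt hq hq (2 * (m + 1))
    have h3 := (mul_eq_zero.1 h.symm).resolve_left h2
    exact (mul_eq_zero.1 h3).resolve_right (by norm_num)
  rw [one_add_mul_qPoch_mul_qPoch_inv hq hz]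
  simp only [zFactor_natCast_add_one hz, mul_sub, sum_sub_distrib, ← sum_mul, h0]
  ring

theorem summable_pow_choose_two_mul_pow {r : ℝ} (hr0 : 0 ≤ r) (hr : r < 1) {y : ℝ} (hy : 0 ≤ y) :
    Summable fun i : ℕ => r ^ i.choose 2 * y ^ i := by
  have hlim : Tendsto (fun i : ℕ => r ^ i * y) atTop (𝓝 0) := by
    simpa using (tendsto_pow_atTop_nhds_zero_of_lt_one hr0 hr).mul_const y
  refine summable_of_ratio_norm_eventually_le (r := 1 / 2) (by norm_num) ?_
  filter_upwards [hlim.eventually_le_const (show (0 : ℝ) < 1 / 2 by norm_num)] with i hi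
  rw [Real.norm_of_nonneg (by positivity), Real.norm_of_nonneg (by positivity),
    Nat.choose_succ_succ', Nat.choose_one_right, pow_add, pow_succ]
  calc r ^ i * r ^ i.choose 2 * (y ^ i * y) = (r ^ i * y) * (r ^ i.choose 2 * y ^ i) := by ring
    _ ≤ _ := mul_le_mul_of_nonneg_right hi (by positivity)

theorem summable_pow_choose_two {r : ℝ} (hr0 : 0 ≤ r) (hr : r < 1) :
    Summable fun i : ℕ => r ^ i.choose 2 := by
  simpa using summable_pow_choose_two_mul_pow hr0 hr zero_le_one

theorem summable_pow_choose_two_mul_zFactor (hq : ‖q‖ < 1) (hz : z ≠ 0) :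
    Summable fun i : ℕ => ‖q‖ ^ i.choose 2 * ‖zFactor z ((i : ℤ) + 1)‖ := by
  have h := summable_pow_choose_two_mul_pow (norm_nonneg q) hq (norm_nonneg z)
  have h' := summable_pow_choose_two_mul_pow (norm_nonneg q) hq (norm_nonneg z⁻¹)
  refine Summable.of_nonneg_of_le (fun i => by positivity) (fun i => ?_)
    (((h.mul_right ‖z‖).add h').add
      ((summable_pow_choose_two (norm_nonneg q) hq).mul_right ‖1 + z‖))
  have : ‖zFactor z ((i : ℤ) + 1)‖ ≤ ‖z‖ ^ i * ‖z‖ + ‖z⁻¹‖ ^ i + ‖1 + z‖ := by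
    rw [zFactor_natCast_add_one hz, ← norm_pow, ← norm_pow, ← norm_mul, ← pow_succ]
    exact (norm_sub_le _ _).trans (add_le_add_left (norm_add_le _ _) _)
  calc _ ≤ _ := mul_le_mul_of_nonneg_left this (by positivity)
    _ = _ := by ring

theorem exists_norm_crankCoeff_le (hq : ‖q‖ < 1) :
    ∃ C, 0 ≤ C ∧ ∀ n i, ‖crankCoeff q n i‖ ≤ C * ‖q‖ ^ i.choose 2 := by
  obtain ⟨K, hK⟩ := exists_norm_inv_qPoch_le hq hq
  have hK0 : 0 ≤ K := (norm_nonneg _).trans (hK 0)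
  refine ⟨2 * (K * K), by positivity, fun n i => ?_⟩
  rw [crankCoeff]
  split_ifs
  · have h1 : ‖1 - q ^ (2 * i + 1)‖ ≤ 2 := by
      refine (norm_sub_le _ _).trans ?_
      rw [norm_one, norm_pow]
      linarith [pow_le_one₀ (n := 2 * i + 1) (norm_nonneg q) hq.le]
    rw [div_eq_mul_inv, mul_inv, norm_mul, norm_mul, norm_mul, norm_mul, norm_pow, norm_neg,
      norm_one, one_pow, one_mul, norm_pow]
    calc _ ≤ ‖q‖ ^ i.choose 2 * 2 * (K * K) := by
          gcongr
          · exact hK _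
          · exact hK _
      _ = _ := by ring
  · rw [norm_zero]
    positivity

theorem qPochInf_mul_pow_ne_zero (hq : ‖q‖ < 1) {a : ℂ} (h : ∀ n : ℕ, 1 ≤ n → a * q ^ n ≠ 1)
    {n : ℕ} (hn : 1 ≤ n) : qPochInf (a * q ^ n) q ≠ 0 :=
  qPochInf_ne_zero hq fun j => by
    rw [mul_assoc, ← pow_add]
    exact h _ (by omega)

/-- The inverse equals `(a q; q)_n / (a q; q)_∞`, whose numerator converges; the excluded poles keep
the denominator nonzero. -/
theorem exists_norm_inv_qPochInf_mul_pow_le (hq : ‖q‖ < 1) {a : ℂ}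
    (h : ∀ n : ℕ, 1 ≤ n → a * q ^ n ≠ 1) :
    ∃ C, ∀ n : ℕ, ‖(qPochInf (a * q ^ (n + 1)) q)⁻¹‖ ≤ C := by
  obtain ⟨C, hC⟩ := exists_norm_qPoch_le hq (a * q)
  refine ⟨C * ‖(qPochInf (a * q) q)⁻¹‖, fun n => ?_⟩
  have h0 := qPochInf_mul_pow_ne_zero hq h (Nat.le_add_left 1 n)
  have h1 : qPochInf (a * q) q ≠ 0 := by simpa using qPochInf_mul_pow_ne_zero hq h le_rfl
  have h2 := qPochInf_eq_mul hq (a * q) n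
  rw [mul_assoc, ← pow_succ'] at h2
  have h3 : (qPochInf (a * q ^ (n + 1)) q)⁻¹ = qPoch (a * q) q n * (qPochInf (a * q) q)⁻¹ := by
    rw [inv_eq_iff_eq_inv, mul_inv, inv_inv, h2]
    have h4 : qPoch (a * q) q n ≠ 0 := fun h' => h1 (by rw [h2, h', zero_mul])
    field_simp
  rw [h3, norm_mul]
  exact mul_le_mul_of_nonneg_right (hC n) (norm_nonneg _)

theorem summable_sptCrankTerm (hq : ‖q‖ < 1)
    (hpole : ∀ n : ℕ, 1 ≤ n → z * q ^ n ≠ 1 ∧ z⁻¹ * q ^ n ≠ 1) {c d : ℕ → ℂ}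
    (hcd : ∀ n, c n * qPoch q q (2 * n) = d n) {C : ℝ} (hd : ∀ n, ‖d n‖ ≤ C * ‖q‖ ^ n) :
    Summable fun n : ℕ+ => sptCrankTerm c z q n := by
  obtain ⟨A, hA⟩ := exists_norm_inv_qPochInf_mul_pow_le hq fun n hn => (hpole n hn).1
  obtain ⟨B, hB⟩ := exists_norm_inv_qPochInf_mul_pow_le hq fun n hn => (hpole n hn).2
  obtain ⟨K, hK⟩ := exists_norm_inv_qPoch_le hq hq
  have hA0 := (norm_nonneg _).trans (hA 0)
  have hB0 := (norm_nonneg _).trans (hB 0)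
  have hK0 := (norm_nonneg _).trans (hK 0)
  have hC0 : 0 ≤ C := by simpa using (norm_nonneg _).trans (hd 0)
  rw [summable_pnat_iff_summable_succ]
  refine Summable.of_norm_bounded (g := fun n => C * ‖q‖ ^ (n + 1) * K * (A * B))
    ((((summable_nat_add_iff 1).2 (summable_geometric_of_lt_one (norm_nonneg q) hq)).mul_left
      C).mul_right K |>.mul_right (A * B)) fun n => ?_
  have hc : c (n + 1) = d (n + 1) * (qPoch q q (2 * (n + 1)))⁻¹ := by
    rw [← hcd, mul_assoc, mul_inv_cancel₀ (qPoch_ne_zero_of_norm_lt hq hq _), mul_one]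
  rw [sptCrankTerm, div_eq_mul_inv, mul_inv, norm_mul, norm_mul, hc, norm_mul]
  gcongr
  · exact hd _
  · exact hK _
  · exact hA n
  · exact hB n

/-- The core reduction: the problem becomes a single sum over `m` for each `i`, free of `z`. -/
theorem hasSum_sptPrefactor_mul (hq : ‖q‖ < 1) (hz : z ≠ 0)
    (hpole : ∀ n : ℕ, 1 ≤ n → z * q ^ n ≠ 1 ∧ z⁻¹ * q ^ n ≠ 1) {c d : ℕ → ℂ}
    (hcd : ∀ n, c n * qPoch q q (2 * n) = d n) {C : ℝ} (hd : ∀ n, ‖d n‖ ≤ C * ‖q‖ ^ n) :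
    HasSum (fun i : ℕ => zFactor z ((i : ℤ) + 1) *
        ((-1) ^ i * q ^ i.choose 2 * (1 - q ^ (2 * i + 1)) *
          ∑' m, d (m + i) / (qPoch q q m * qPoch q q (m + (2 * i + 1)))))
      (sptPrefactor z q * sptCrankSeries c z q) := by
  obtain ⟨K, hK0, hK⟩ := exists_norm_crankCoeff_le hq
  have hC0 : 0 ≤ C := by simpa using (norm_nonneg _).trans (hd 0)
  -- The bounds on `d` and on `crankCoeff` separate the variables: geometric decay in `n`, and
  -- `‖q‖^(i(i-1)/2)` against at most exponential growth of `zFactor` in `i`.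
  have hT : Summable fun p : ℕ × ℕ =>
      d p.1 * (crankCoeff q p.1 p.2 * zFactor z ((p.2 : ℤ) + 1)) := by
    have hg := ((summable_geometric_of_lt_one (norm_nonneg q) hq).mul_left (C * K)).mul_of_nonneg
      (summable_pow_choose_two_mul_zFactor hq hz) (fun _ => by positivity)
      (fun _ => by positivity)
    refine Summable.of_norm_bounded hg ?_
    rintro ⟨n, i⟩
    rw [norm_mul, norm_mul]
    calc _ ≤ C * ‖q‖ ^ n * (K * ‖q‖ ^ i.choose 2 * ‖zFactor z ((i : ℤ) + 1)‖) := by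
          gcongr
          · exact hd n
          · exact hK n i
      _ = _ := by ring
  have hrow : ∀ n, HasSum (fun i => d n * (crankCoeff q n i * zFactor z ((i : ℤ) + 1)))
      (∑ i ∈ range (n + 1), d n * (crankCoeff q n i * zFactor z ((i : ℤ) + 1))) := fun n =>
    hasSum_sum_of_ne_finset_zero fun i hi => by
      rw [crankCoeff_of_lt q (by simpa using hi), zero_mul, mul_zero]
  have hterm : ∀ n, n ≠ 0 →
      ∑ i ∈ range (n + 1), d n * (crankCoeff q n i * zFactor z ((i : ℤ) + 1))
        = sptPrefactor z q * sptCrankTerm c z q n := by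
    intro n hn
    have h1 := qPochInf_mul_pow_ne_zero hq (fun n hn => (hpole n hn).1)
      (Nat.one_le_iff_ne_zero.2 hn)
    have h2 := qPochInf_mul_pow_ne_zero hq (fun n hn => (hpole n hn).2)
      (Nat.one_le_iff_ne_zero.2 hn)
    rw [← mul_sum, ← hcd, mul_assoc, ← one_add_mul_qPoch_eq_sum_zFactor hq hz hn, sptPrefactor,
      sptCrankTerm, qPochInf_eq_mul hq z n, qPochInf_eq_mul hq z⁻¹ n]
    generalize qPochInf (z * q ^ n) q = u at h1 ⊢
    generalize qPochInf (z⁻¹ * q ^ n) q = v at h2 ⊢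
    generalize z⁻¹ = w
    field_simp
  have htot : HasSum (fun p : ℕ × ℕ =>
      d p.1 * (crankCoeff q p.1 p.2 * zFactor z ((p.2 : ℤ) + 1)))
      (sptPrefactor z q * sptCrankSeries c z q) := by
    have h1 := hT.hasSum.prod_fiberwise hrow
    have h2 : sptPrefactor z q * sptCrankSeries c z q = ∑' n,
        ∑ i ∈ range (n + 1), d n * (crankCoeff q n i * zFactor z ((i : ℤ) + 1)) := by
      -- The row `n = 0` contains only `zFactor z 1 = 0`, so summing over all naturals is harmless.
      rw [← tsum_pnat_eq_tsum_of_eq_zero (by simp [zFactor_one]), sptCrankSeries, ← tsum_mul_left]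
      exact tsum_congr fun n => (hterm n n.ne_zero).symm
    rw [h2, h1.tsum_eq]
    exact hT.hasSum
  refine HasSum.prod_fiberwise ((Equiv.prodComm ℕ ℕ).hasSum_iff.2 htot) fun i => ?_
  have hsum : Summable fun n => d n * (crankCoeff q n i * zFactor z ((i : ℤ) + 1)) :=
    hT.prod_symm.prod_factor i
  have hval : ∑' n, d n * (crankCoeff q n i * zFactor z ((i : ℤ) + 1))
      = zFactor z ((i : ℤ) + 1) * ((-1) ^ i * q ^ i.choose 2 * (1 - q ^ (2 * i + 1)) *
          ∑' m, d (m + i) / (qPoch q q m * qPoch q q (m + (2 * i + 1)))) := by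
    -- Column `i` is supported on `n ≥ i`; hence `n = m + i`.
    rw [← hsum.sum_add_tsum_nat_add i, sum_eq_zero, zero_add, ← tsum_mul_left, ← tsum_mul_left]
    · refine tsum_congr fun m => ?_
      rw [add_comm m i, crankCoeff_add,
        show 2 * i + m + 1 = m + (2 * i + 1) by ring]
      ring
    · intro n hn
      rw [crankCoeff_of_lt q (by simpa using hn), zero_mul, mul_zero]
  rw [← hval]
  exact hsum.hasSum

end CrankSeries

/-- The partial theta series `∑_{n ≥ 0} (-1) ^ n q ^ (n (n - 1) / 2) x ^ n`. -/
def qTheta (x q : ℂ) : ℂ := ∑' n : ℕ, (-1) ^ n * q ^ n.choose 2 * x ^ n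

/-! ### Partial theta series and their functional equation. -/

section Theta

variable {q : ℂ}

theorem hasSum_qTheta (hq : ‖q‖ < 1) (x : ℂ) :
    HasSum (fun n : ℕ => (-1) ^ n * q ^ n.choose 2 * x ^ n) (qTheta x q) := by
  refine Summable.hasSum (Summable.of_norm ?_)
  simpa using summable_pow_choose_two_mul_pow (norm_nonneg q) hq (norm_nonneg x)

theorem qTheta_eq_one_sub (hq : ‖q‖ < 1) (x : ℂ) : qTheta x q = 1 - x * qTheta (q * x) q := by
  rw [qTheta, (hasSum_qTheta hq x).summable.tsum_eq_zero_add, qTheta, ← tsum_mul_left,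
    sub_eq_add_neg, ← tsum_neg]
  congr 1
  · simp
  · refine tsum_congr fun n => ?_
    rw [pow_choose_two_succ]
    ring

theorem norm_qTheta_le (hq : ‖q‖ < 1) {x : ℂ} (hx : ‖x‖ ≤ 1) :
    ‖qTheta x q‖ ≤ ∑' n : ℕ, ‖q‖ ^ n.choose 2 :=
  tsum_of_norm_bounded (summable_pow_choose_two (norm_nonneg q) hq).hasSum fun n => by
    rw [norm_mul, norm_mul, norm_pow, norm_pow, norm_neg, norm_one, one_pow, one_mul, norm_pow]
    exact mul_le_of_le_one_right (by positivity) (pow_le_one₀ (norm_nonneg _) hx)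

theorem hasSum_of_eq {ι : Type*} {f g : ι → ℂ} {a b : ℂ} (h : HasSum f a) (hf : ∀ n, g n = f n)
    (hab : b = a) : HasSum g b := by
  rwa [hab, funext hf]

/-- The series is `(θ(x) - 1) + (θ(q x) - 1)`, and `θ(x) = 1 - x θ(q x)`. With `x = q^(2i+1)` it
absorbs the factor `1 - q^(2i+1)` of the A1 coefficients. -/
theorem one_sub_mul_qTheta (hq : ‖q‖ < 1) (x : ℂ) :
    HasSum (fun n : ℕ => (-1) ^ (n + 1) * q ^ (n + 1).choose 2 * x ^ (n + 1) * (1 + q ^ (n + 1)))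
      ((1 - x) * qTheta (q * x) q - 1) := by
  have h1 := (hasSum_nat_add_iff' 1).2 (hasSum_qTheta hq x)
  have h2 := (hasSum_nat_add_iff' 1).2 (hasSum_qTheta hq (q * x))
  refine hasSum_of_eq (h1.add h2) (fun n => ?_) ?_
  · ring
  · simp only [sum_range_one, pow_zero, Nat.choose_zero_succ]
    linear_combination -qTheta_eq_one_sub hq x

/-- The series is `θ(x) - q θ(q² x)`; two uses of the functional equation give the product form
needed for A3. -/
theorem one_sub_mul_qTheta_sub (hq : ‖q‖ < 1) (x : ℂ) :
    HasSum (fun n : ℕ => (-1) ^ n * q ^ n.choose 2 * x ^ n * (1 - q ^ (2 * n + 1)))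
      ((1 - x) * (qTheta (q * x) q - q * qTheta (q ^ 2 * x) q)) := by
  refine hasSum_of_eq ((hasSum_qTheta hq x).sub ((hasSum_qTheta hq (q ^ 2 * x)).mul_left q))
    (fun n => ?_) ?_
  · ring
  · have h := qTheta_eq_one_sub hq (q * x)
    rw [show q * (q * x) = q ^ 2 * x by ring] at h
    linear_combination h - qTheta_eq_one_sub hq x

end Theta

/-! ### Special `q`-binomial coefficients and reciprocal factorials. -/

section Coefficients

variable {q : ℂ}

theorem qBinCoeff_right_zero (b q : ℂ) (n : ℕ) : qBinCoeff b 0 q n = b ^ n / qPoch q q n := by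
  simp [qBinCoeff]

/-- The homogeneous normalization makes sense at `b = 0`, where `b^n (a/b; q)_n` is only a limit;
this is how partial theta terms arise from Heine's transformation. -/
theorem qBinCoeff_left_zero (a q : ℂ) (n : ℕ) :
    qBinCoeff 0 a q n = (-1) ^ n * q ^ n.choose 2 * a ^ n / qPoch q q n := by
  rw [qBinCoeff]
  congr 1
  induction n with
  | zero => simp
  | succ n ih =>
    rw [prod_range_succ, ih, pow_choose_two_succ]
    ring

theorem qBinCoeff_mul (b a q : ℂ) (n : ℕ) :
    qBinCoeff b (b * a) q n = b ^ n * qPoch a q n / qPoch q q n := by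
  rw [qBinCoeff]
  congr 1
  induction n with
  | zero => simp
  | succ n ih =>
    rw [prod_range_succ, ih, qPoch_succ]
    ring

theorem qPochInf_self_eq (hq : ‖q‖ < 1) (n : ℕ) :
    qPochInf q q = qPoch q q n * qPochInf (q ^ (n + 1)) q := by
  rw [pow_succ', ← qPochInf_eq_mul hq]

/-- Puts the denominators of the inner sums into the infinite-product form required by `heine_symm`.
-/
theorem inv_qPoch_self_add (hq : ‖q‖ < 1) (m N : ℕ) :
    (qPoch q q (m + N))⁻¹ = qPochInf (q ^ (N + 1) * q ^ m) q / qPochInf q q := by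
  have h1 := qPoch_ne_zero_of_norm_lt hq hq (m + N)
  have h2 := qPochInf_ne_zero_of_norm_lt hq hq
  rw [eq_div_iff h2, qPochInf_self_eq hq (m + N), ← mul_assoc, inv_mul_cancel₀ h1, one_mul,
    ← pow_add, show m + N + 1 = N + 1 + m by ring]

theorem inv_qPochInf_self (hq : ‖q‖ < 1) (r : ℕ) :
    (qPochInf (q ^ (r + 1)) q)⁻¹ = qPoch q q r / qPochInf q q := by
  have h0 := qPochInf_ne_zero_of_norm_lt hq hq
  have h2 := qPochInf_self_eq hq r
  have h3 : qPochInf (q ^ (r + 1)) q ≠ 0 := fun h => h0 (by rw [h2, h, mul_zero])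
  rw [eq_div_iff h0, h2, mul_comm (qPoch q q r), ← mul_assoc, inv_mul_cancel₀ h3, one_mul]

theorem norm_pow_succ_lt_one (hq : ‖q‖ < 1) (n : ℕ) : ‖q ^ (n + 1)‖ < 1 := by
  rw [norm_pow]
  exact pow_lt_one₀ (norm_nonneg _) hq n.succ_ne_zero

end Coefficients

/-! ### Inner sums for A1, A3, A5 and A7. -/

section GroupA

variable {q : ℂ}

/-- Heine with `b = q`, `a = b' = 0`, `a' = q^(N+1)`: on the other side `1/(q^(r+1); q)_∞` cancels
the denominator `(q; q)_r`, leaving a partial theta series. -/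
theorem tsum_pow_div_qPoch (hq : ‖q‖ < 1) (N : ℕ) :
    ∑' m, q ^ m / (qPoch q q m * qPoch q q (m + N))
      = qTheta (q ^ (N + 1)) q / qPochInf q q ^ 2 := by
  have h := heine_symm hq hq (b' := 0) (by simp) 0 (q ^ (N + 1))
  simp only [zero_mul, qPochInf_zero, div_one, qBinCoeff_right_zero, qBinCoeff_left_zero] at h
  have h1 : ∀ m, q ^ m / (qPoch q q m * qPoch q q (m + N))
      = q ^ m / qPoch q q m * qPochInf (q ^ (N + 1) * q ^ m) q * (qPochInf q q)⁻¹ := fun m => by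
    rw [div_mul_eq_div_div, div_eq_mul_inv, inv_qPoch_self_add hq]
    ring
  have h2 : ∀ r, (-1) ^ r * q ^ r.choose 2 * (q ^ (N + 1)) ^ r / qPoch q q r *
        (1 / qPochInf (q * q ^ r) q)
      = (-1) ^ r * q ^ r.choose 2 * (q ^ (N + 1)) ^ r * (qPochInf q q)⁻¹ := fun r => by
    have := qPoch_ne_zero_of_norm_lt hq hq r
    rw [← pow_succ', one_div, inv_qPochInf_self hq]
    field_simp
  simp only [h1, tsum_mul_right, h, h2, qTheta]
  ring

/-- As before with `b = q²`; the cancellation leaves an extra `1 - q^(r+1)`, which splits the result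
into two theta series. -/
theorem tsum_pow_two_mul_div_qPoch (hq : ‖q‖ < 1) (N : ℕ) :
    ∑' m, q ^ (2 * m) / (qPoch q q m * qPoch q q (m + N))
      = (qTheta (q ^ (N + 1)) q - q * qTheta (q ^ (N + 2)) q) / qPochInf q q ^ 2 := by
  have h := heine_symm hq (norm_sq_lt_one hq) (b' := 0) (by simp) 0 (q ^ (N + 1))
  simp only [zero_mul, qPochInf_zero, div_one, qBinCoeff_right_zero, qBinCoeff_left_zero] at h
  have h1 : ∀ m, q ^ (2 * m) / (qPoch q q m * qPoch q q (m + N))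
      = (q ^ 2) ^ m / qPoch q q m * qPochInf (q ^ (N + 1) * q ^ m) q * (qPochInf q q)⁻¹ :=
    fun m => by
      rw [div_mul_eq_div_div, div_eq_mul_inv, inv_qPoch_self_add hq, pow_mul]
      ring
  have h2 : ∀ r, (-1) ^ r * q ^ r.choose 2 * (q ^ (N + 1)) ^ r / qPoch q q r *
        (1 / qPochInf (q ^ 2 * q ^ r) q)
      = ((-1) ^ r * q ^ r.choose 2 * (q ^ (N + 1)) ^ r
        - q * ((-1) ^ r * q ^ r.choose 2 * (q ^ (N + 2)) ^ r)) * (qPochInf q q)⁻¹ := fun r => by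
    have := qPoch_ne_zero_of_norm_lt hq hq r
    rw [← pow_add, show 2 + r = r + 1 + 1 by ring, one_div, inv_qPochInf_self hq, qPoch_self_succ]
    field_simp
    ring
  simp only [h1, tsum_mul_right, h, h2]
  rw [Summable.tsum_sub (hasSum_qTheta hq _).summable
    ((hasSum_qTheta hq _).summable.mul_left q), tsum_mul_left, ← qTheta, ← qTheta]
  ring

/-- The summands of the Durfee rectangle series. -/
theorem summable_durfee (hq : ‖q‖ < 1) (M N : ℕ) :
    Summable fun m => q ^ (m ^ 2 + M * m) / (qPoch q q m * qPoch q q (m + N)) := by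
  obtain ⟨K, hK⟩ := exists_norm_inv_qPoch_le hq hq
  have hK0 := (norm_nonneg _).trans (hK 0)
  refine Summable.of_norm_bounded
    ((summable_geometric_of_lt_one (norm_nonneg q) hq).mul_right (K * K)) fun m => ?_
  rw [div_eq_mul_inv, mul_inv, norm_mul, norm_mul, norm_pow]
  gcongr ?_ * (?_ * ?_)
  · exact pow_le_pow_of_le_one (norm_nonneg _) hq.le (by nlinarith)
  · exact hK _
  · exact hK _

/-- In the difference of the two series with the same `N` the factor `1 - q^m` cancels the last
factor of `(q; q)_m`; then `m` is shifted. -/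
theorem durfee_split (hq : ‖q‖ < 1) (M N : ℕ) :
    ∑' m, q ^ (m ^ 2 + M * m) / (qPoch q q m * qPoch q q (m + N))
      = ∑' m, q ^ (m ^ 2 + (M + 1) * m) / (qPoch q q m * qPoch q q (m + N))
        + q ^ (M + 1) *
          ∑' m, q ^ (m ^ 2 + (M + 2) * m) / (qPoch q q m * qPoch q q (m + (N + 1))) := by
  have h0 := summable_durfee hq M N
  have h1 := summable_durfee hq (M + 1) N
  rw [← sub_eq_iff_eq_add', ← h0.tsum_sub h1, (h0.sub h1).tsum_eq_zero_add, ← tsum_mul_left]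
  simp only [mul_zero, sub_self, zero_add]
  refine tsum_congr fun m => ?_
  have h2 := qPoch_ne_zero_of_norm_lt hq hq m
  have h3 := qPoch_ne_zero_of_norm_lt hq hq (m + (N + 1))
  have h4 := one_sub_pow_ne_zero hq m
  rw [show m + 1 + N = m + (N + 1) by ring, qPoch_self_succ]
  field_simp
  ring

/-- Combines `durfee_split` with `1/(q; q)_(m+N) = (1 - q^(m+N+1)) / (q; q)_(m+N+1)`. The resulting
recurrence for consecutive differences is contracting, so bounded differences must vanish. -/
theorem durfee_sub_succ (hq : ‖q‖ < 1) (N : ℕ) :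
    ∑' m, q ^ (m ^ 2 + N * m) / (qPoch q q m * qPoch q q (m + N))
        - ∑' m, q ^ (m ^ 2 + (N + 1) * m) / (qPoch q q m * qPoch q q (m + (N + 1)))
      = -q ^ (N + 1) *
        (∑' m, q ^ (m ^ 2 + (N + 1) * m) / (qPoch q q m * qPoch q q (m + (N + 1)))
        - ∑' m, q ^ (m ^ 2 + (N + 2) * m) / (qPoch q q m * qPoch q q (m + (N + 2)))) := by
  have h1 := durfee_split hq N (N + 1)
  have h2 : ∑' m, q ^ (m ^ 2 + N * m) / (qPoch q q m * qPoch q q (m + N))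
      = ∑' m, q ^ (m ^ 2 + N * m) / (qPoch q q m * qPoch q q (m + (N + 1)))
        - q ^ (N + 1) *
          ∑' m, q ^ (m ^ 2 + (N + 1) * m) / (qPoch q q m * qPoch q q (m + (N + 1))) := by
    rw [← tsum_mul_left, ← (summable_durfee hq N (N + 1)).tsum_sub
      ((summable_durfee hq (N + 1) (N + 1)).mul_left _)]
    refine tsum_congr fun m => ?_
    have h2 := qPoch_ne_zero_of_norm_lt hq hq m
    have h3 := qPoch_ne_zero_of_norm_lt hq hq (m + N)
    have h4 := one_sub_pow_ne_zero hq (m + N)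
    rw [← add_assoc m N 1, qPoch_self_succ]
    field_simp
    ring
  rw [h2, h1]
  ring

/-- The Durfee rectangle identity. -/
theorem tsum_durfee (hq : ‖q‖ < 1) (N : ℕ) :
    ∑' m, q ^ (m ^ 2 + N * m) / (qPoch q q m * qPoch q q (m + N)) = (qPochInf q q)⁻¹ := by
  set D : ℕ → ℂ := fun N => ∑' m, q ^ (m ^ 2 + N * m) / (qPoch q q m * qPoch q q (m + N)) with hD
  obtain ⟨K, hK⟩ := exists_norm_inv_qPoch_le hq hq
  have hK0 := (norm_nonneg _).trans (hK 0)
  have hgeo := summable_geometric_of_lt_one (norm_nonneg q) hq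
  have hle : ∀ N m, ‖q ^ (m ^ 2 + N * m) / (qPoch q q m * qPoch q q (m + N))‖
      ≤ ‖q‖ ^ m * (K * K) := fun N m => by
    rw [div_eq_mul_inv, mul_inv, norm_mul, norm_mul, norm_pow]
    gcongr ?_ * (?_ * ?_)
    · exact pow_le_pow_of_le_one (norm_nonneg _) hq.le (by nlinarith)
    · exact hK _
    · exact hK _
  have hbound : ∀ N, ‖D N‖ ≤ ∑' m, ‖q‖ ^ m * (K * K) := fun N =>
    tsum_of_norm_bounded (hgeo.mul_right _).hasSum (hle N)
  have hconst : ∀ N, D N - D (N + 1) = 0 :=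
    eq_zero_of_eq_mul_succ (δ := fun N => D N - D (N + 1)) (norm_nonneg q) hq
      (fun N => durfee_sub_succ hq N)
      (fun N => by
        rw [norm_neg, norm_pow]
        exact pow_le_of_le_one (norm_nonneg _) hq.le N.succ_ne_zero)
      fun N => (norm_sub_le _ _).trans (add_le_add (hbound N) (hbound (N + 1)))
  have hall : ∀ n, D (N + n) = D N := by
    intro n
    induction n with
    | zero => rfl
    | succ n ih => rw [← ih, eq_comm, ← sub_eq_zero]; exact hconst (N + n)
  -- The constant value is found as `N → ∞`, where only the term `m = 0` survives.
  have hlim : Tendsto (fun N => D N) atTop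
      (𝓝 (∑' m, if m = 0 then (qPochInf q q)⁻¹ else 0)) := by
    refine tendsto_tsum_of_dominated_convergence (hgeo.mul_right (K * K)) (fun m => ?_)
      (Eventually.of_forall fun N m => hle N m)
    rcases m with _ | m
    · simpa using (tendsto_qPoch hq q).inv₀ (qPochInf_ne_zero_of_norm_lt hq hq)
    · rw [if_neg m.succ_ne_zero]
      refine squeeze_zero_norm (a := fun N => ‖q‖ ^ N * (K * K)) (fun N => ?_) ?_
      · rw [div_eq_mul_inv, mul_inv, norm_mul, norm_mul, norm_pow]
        gcongr ?_ * (?_ * ?_)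
        · exact pow_le_pow_of_le_one (norm_nonneg _) hq.le (by nlinarith)
        · exact hK _
        · exact hK _
      · simpa using
          (tendsto_pow_atTop_nhds_zero_of_lt_one (norm_nonneg q) hq).mul_const (K * K)
  rw [tsum_ite_eq] at hlim
  refine tendsto_nhds_unique (f := fun _ : ℕ => D N) (l := atTop) tendsto_const_nhds ?_
  have h := hlim.comp (tendsto_add_atTop_nat N)
  refine h.congr fun n => ?_
  rw [Function.comp_apply, add_comm n N, hall]

theorem tsum_durfee_succ (hq : ‖q‖ < 1) (M : ℕ) :
    ∑' m, q ^ (m ^ 2 + M * m) / (qPoch q q m * qPoch q q (m + (M + 1)))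
      = (1 + q ^ (M + 1)) / qPochInf q q := by
  rw [durfee_split hq, tsum_durfee hq, tsum_durfee hq (M + 2)]
  ring

end GroupA

/-! ### Inner sums for C1 and C5. -/

section GroupC

variable {q : ℂ}

/-- Uniformity in `j` gives the boundedness along the orbit `a q^j` that `eq_zero_of_eq_mul_succ`
requires. -/
theorem exists_norm_inv_qPoch_mul_pow_le (hq : ‖q‖ < 1) {a : ℂ} (ha : ‖a‖ < 1) :
    ∃ C, ∀ j n, ‖(qPoch (a * q ^ j) q n)⁻¹‖ ≤ C := by
  obtain ⟨A, hA⟩ := exists_norm_qPoch_le hq a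
  obtain ⟨B, hB⟩ := exists_norm_inv_qPoch_le hq ha
  have hA0 := (norm_nonneg _).trans (hA 0)
  refine ⟨A * B, fun j n => ?_⟩
  have h : (qPoch (a * q ^ j) q n)⁻¹ = qPoch a q j * (qPoch a q (j + n))⁻¹ := by
    have := qPoch_ne_zero_of_norm_lt hq ha j
    rw [qPoch_add, mul_inv, ← mul_assoc, mul_inv_cancel₀ this, one_mul]
  rw [h, norm_mul]
  gcongr
  · exact hA _
  · exact hB _

theorem exists_norm_qPoch_mul_pow_le (hq : ‖q‖ < 1) {a : ℂ} (ha : ‖a‖ < 1) :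
    ∃ C, ∀ j n, ‖qPoch (a * q ^ j) q n‖ ≤ C := by
  obtain ⟨A, hA⟩ := exists_norm_inv_qPoch_le hq ha
  obtain ⟨B, hB⟩ := exists_norm_qPoch_le hq a
  have hA0 := (norm_nonneg _).trans (hA 0)
  refine ⟨A * B, fun j n => ?_⟩
  have h : qPoch (a * q ^ j) q n = (qPoch a q j)⁻¹ * qPoch a q (j + n) := by
    have := qPoch_ne_zero_of_norm_lt hq ha j
    rw [qPoch_add, ← mul_assoc, inv_mul_cancel₀ this, one_mul]
  rw [h, norm_mul]
  gcongr
  · exact hA _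
  · exact hB _

theorem norm_cube_lt_one (hq : ‖q‖ < 1) : ‖q ^ 3‖ < 1 := norm_pow_succ_lt_one hq 2

theorem hasSum_cubic_qTheta (hq : ‖q‖ < 1) (y : ℂ) :
    HasSum (fun n : ℕ => q ^ (3 * n.choose 2 + n) * y ^ (3 * n) * (1 - y * q ^ n))
      (qTheta (-(q * y ^ 3)) (q ^ 3) - y * qTheta (-(q ^ 2 * y ^ 3)) (q ^ 3)) := by
  have h3 := norm_cube_lt_one hq
  refine hasSum_of_eq ((hasSum_qTheta h3 _).sub ((hasSum_qTheta h3 _).mul_left y)) (fun n => ?_) rfl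
  have h : ((-1 : ℂ)) ^ n * (-1) ^ n = 1 := by rw [← mul_pow]; simp
  rw [neg_pow (q * y ^ 3), neg_pow (q ^ 2 * y ^ 3)]
  linear_combination (-q ^ (3 * n.choose 2 + n) * y ^ (3 * n) * (1 - y * q ^ n)) * h

theorem summable_pow_choose_two_div_qPoch (hq : ‖q‖ < 1) {y : ℂ} (hy : ‖y‖ < 1) (x : ℂ) :
    Summable fun n : ℕ => (-1) ^ n * q ^ n.choose 2 * x ^ n / qPoch (-y) q (n + 1) := by
  obtain ⟨C, hC⟩ := exists_norm_inv_qPoch_le hq (a := -y) (by simpa using hy)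
  refine Summable.of_norm_bounded ((hasSum_qTheta hq x).summable.norm.mul_right C) fun n => ?_
  rw [div_eq_mul_inv, norm_mul _ (qPoch (-y) q (n + 1))⁻¹]
  exact mul_le_mul_of_nonneg_left (hC _) (norm_nonneg _)

/-- Two relations are eliminated against each other: the term ratio of the series at `y`, and `(-y;
q)_(n+2) = (1 + y) (-y q; q)_(n+1)`, which expresses the series at `y q` through the terms at `y`.
-/
theorem tsum_pow_choose_two_div_qPoch_rec (hq : ‖q‖ < 1) {y : ℂ} (hy : ‖y‖ < 1) :
    ∑' n : ℕ, (-1) ^ n * q ^ n.choose 2 * (y ^ 2) ^ n / qPoch (-y) q (n + 1)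
      = 1 - y + q * y ^ 3 *
        ∑' n : ℕ, (-1) ^ n * q ^ n.choose 2 * ((y * q) ^ 2) ^ n / qPoch (-(y * q)) q (n + 1) := by
  have hny : ‖-y‖ < 1 := by simpa using hy
  have hyq : ‖y * q‖ < 1 := by simpa using norm_mul_pow_lt_one hq hy 1
  have hne : ∀ n, 1 + y * q ^ n ≠ 0 := fun n h =>
    mul_pow_ne_one hq hny n (by linear_combination -h)
  have hne0 : 1 + y ≠ 0 := by simpa using hne 0
  have hP := qPoch_ne_zero_of_norm_lt hq hny
  have hu := summable_pow_choose_two_div_qPoch hq hy (y ^ 2)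
  set u : ℕ → ℂ := fun n => (-1) ^ n * q ^ n.choose 2 * (y ^ 2) ^ n / qPoch (-y) q (n + 1) with hu'
  have hu0 : u 0 * (1 + y) = 1 := by
    simp only [hu', pow_zero, Nat.choose_zero_succ, qPoch_succ, qPoch_zero, mul_one, one_mul,
      sub_neg_eq_add]
    exact div_mul_cancel₀ 1 hne0
  have hmul : ∀ n, u (n + 1) * (1 + y * q ^ (n + 1)) = -(y ^ 2 * q ^ n) * u n := fun n => by
    have h1 := hne (n + 1)
    have h2 := hP (n + 1)
    simp only [hu', qPoch_succ (-y) q (n + 1), pow_choose_two_succ]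
    rw [show 1 - -y * q ^ (n + 1) = 1 + y * q ^ (n + 1) by ring]
    field_simp
    ring
  have hqu : Summable fun n => q ^ n * u n := by
    refine Summable.of_norm_bounded hu.norm fun n => ?_
    rw [norm_mul, norm_pow]
    exact mul_le_of_le_one_left (norm_nonneg _) (pow_le_one₀ (norm_nonneg _) hq.le)
  have hstep : ∑' n, (-1) ^ n * q ^ n.choose 2 * ((y * q) ^ 2) ^ n / qPoch (-(y * q)) q (n + 1)
        * (q * y ^ 2) = ∑' n, q ^ (n + 1) * u (n + 1) * (-(1 + y)) := by
    refine tsum_congr fun n => ?_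
    have h1 := hP (n + 2)
    have h2 : qPoch (-y) q (n + 2) = (1 + y) * qPoch (-(y * q)) q (n + 1) := by
      rw [qPoch_succ', sub_neg_eq_add, neg_mul]
    have h3 : qPoch (-(y * q)) q (n + 1) ≠ 0 := fun h => h1 (by rw [h2, h, mul_zero])
    simp only [hu', pow_choose_two_succ, show n + 1 + 1 = n + 2 by ring, h2]
    field_simp
    ring
  rw [tsum_mul_right, tsum_mul_right] at hstep
  have hA := hu.tsum_eq_zero_add
  have hQ := hqu.tsum_eq_zero_add
  have hrec : ∑' n, u (n + 1) + y * ∑' n, q ^ (n + 1) * u (n + 1)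
      = -y ^ 2 * ∑' n, q ^ n * u n := by
    rw [← tsum_mul_left, ← tsum_mul_left, ← ((summable_nat_add_iff 1).2 hu).tsum_add
      (((summable_nat_add_iff 1).2 hqu).mul_left y)]
    exact tsum_congr fun n => by linear_combination hmul n
  rw [pow_zero, one_mul] at hQ
  linear_combination (1 - y) * hu0 + hA + hrec - y ^ 2 * hQ - y * hstep

/-- Both sides solve `F(y) = 1 - y + q y³ F(y q)` and stay bounded along `y q^j`; their difference
is multiplied by a coefficient of norm at most `‖q‖` at each step. -/
theorem tsum_pow_choose_two_div_qPoch (hq : ‖q‖ < 1) {y : ℂ} (hy : ‖y‖ < 1) :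
    ∑' n : ℕ, (-1) ^ n * q ^ n.choose 2 * (y ^ 2) ^ n / qPoch (-y) q (n + 1)
      = qTheta (-(q * y ^ 3)) (q ^ 3) - y * qTheta (-(q ^ 2 * y ^ 3)) (q ^ 3) := by
  have h3 := norm_cube_lt_one hq
  obtain ⟨C, hC⟩ := exists_norm_inv_qPoch_mul_pow_le hq (a := -y) (by simpa using hy)
  have hC0 := (norm_nonneg _).trans (hC 0 0)
  have hyj := norm_mul_pow_lt_one hq hy
  set f : ℂ → ℂ := fun y =>
    ∑' n : ℕ, (-1) ^ n * q ^ n.choose 2 * (y ^ 2) ^ n / qPoch (-y) q (n + 1) with hf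
  set R : ℂ → ℂ := fun y =>
    qTheta (-(q * y ^ 3)) (q ^ 3) - y * qTheta (-(q ^ 2 * y ^ 3)) (q ^ 3) with hR
  have hRrec : ∀ y, R y = 1 - y + q * y ^ 3 * R (y * q) := fun y => by
    have h1 := qTheta_eq_one_sub h3 (-(q * y ^ 3))
    have h2 := qTheta_eq_one_sub h3 (-(q ^ 2 * y ^ 3))
    simp only [hR]
    rw [show -(q * (y * q) ^ 3) = q ^ 3 * -(q * y ^ 3) by ring,
      show -(q ^ 2 * (y * q) ^ 3) = q ^ 3 * -(q ^ 2 * y ^ 3) by ring]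
    linear_combination h1 - y * h2
  have hfC : ∀ j, ‖f (y * q ^ j)‖ ≤ ∑' n : ℕ, ‖q‖ ^ n.choose 2 * C := fun j => by
    refine tsum_of_norm_bounded
      ((summable_pow_choose_two (norm_nonneg q) hq).mul_right C).hasSum fun n => ?_
    rw [div_eq_mul_inv, norm_mul, norm_mul, norm_mul, norm_pow, norm_pow, norm_neg, norm_one,
      one_pow, one_mul, norm_pow, norm_pow, ← neg_mul]
    gcongr
    · exact mul_le_of_le_one_right (by positivity)
        (pow_le_one₀ (by positivity) (pow_le_one₀ (norm_nonneg _) (hyj j).le))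
    · exact hC j (n + 1)
  have hcoef : ∀ c w : ℂ, ‖c‖ < 1 → ‖w‖ < 1 → ‖-(c * w ^ 3)‖ ≤ 1 := fun c w hc hw => by
    rw [norm_neg, norm_mul, norm_pow]
    exact mul_le_one₀ hc.le (by positivity) (pow_le_one₀ (norm_nonneg _) hw.le)
  have hRC : ∀ j, ‖R (y * q ^ j)‖ ≤
      ∑' n : ℕ, ‖q ^ 3‖ ^ n.choose 2 + 1 * ∑' n : ℕ, ‖q ^ 3‖ ^ n.choose 2 := fun j => by
    refine (norm_sub_le _ _).trans (add_le_add ?_ ?_)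
    · exact norm_qTheta_le h3 (hcoef _ _ hq (hyj j))
    · rw [norm_mul]
      exact mul_le_mul (hyj j).le (norm_qTheta_le h3 (hcoef _ _ (norm_sq_lt_one hq) (hyj j)))
        (norm_nonneg _) zero_le_one
  have hz := eq_zero_of_eq_mul_succ (δ := fun j => f (y * q ^ j) - R (y * q ^ j))
    (c := fun j => q * (y * q ^ j) ^ 3) (norm_nonneg q) hq
    (fun j => by
      have h1 := tsum_pow_choose_two_div_qPoch_rec hq (hyj j)
      have h2 := hRrec (y * q ^ j)
      rw [mul_assoc y, ← pow_succ] at h1 h2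
      simp only [hf] at h1 h2 ⊢
      linear_combination h1 - h2)
    (fun j => by
      rw [norm_mul, norm_pow]
      exact mul_le_of_le_one_right (norm_nonneg _) (pow_le_one₀ (norm_nonneg _) (hyj j).le))
    (fun j => (norm_sub_le _ _).trans (add_le_add (hfC j) (hRC j))) 0
  simpa [sub_eq_zero] using hz

theorem qPoch_neg_self_add (q : ℂ) (m i : ℕ) :
    qPoch (-q) q (m + i) = qPoch (-q) q i * qPoch (-q ^ (i + 1)) q m := by
  rw [add_comm, qPoch_add, neg_mul, ← pow_succ']

/-- With `y = q^(i+1)`, Heine for `b = q`, `a = -q y`, `b' = 0`, `a' = y²` yields the series of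
`tsum_pow_choose_two_div_qPoch`. -/
theorem tsum_pow_mul_qPoch_neg_div (hq : ‖q‖ < 1) (i : ℕ) :
    ∑' m, q ^ m * qPoch (-q) q (m + i) / (qPoch q q m * qPoch q q (m + (2 * i + 1)))
      = qPochInf (-q) q / qPochInf q q ^ 2 *
        (qTheta (-(q * (q ^ (i + 1)) ^ 3)) (q ^ 3)
          - q ^ (i + 1) * qTheta (-(q ^ 2 * (q ^ (i + 1)) ^ 3)) (q ^ 3)) := by
  have hy := norm_pow_succ_lt_one hq i
  rw [← tsum_pow_choose_two_div_qPoch hq hy]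
  have e : q ^ (2 * i + 1 + 1) = (q ^ (i + 1)) ^ 2 := by ring
  have hneg : qPochInf (-q) q = qPoch (-q) q i * qPochInf (-q ^ (i + 1)) q := by
    rw [qPochInf_eq_mul hq (-q) i, neg_mul, ← pow_succ']
  set y := q ^ (i + 1) with hy'
  have hny : ‖-y‖ < 1 := by simpa using hy
  have h := heine_symm hq hq (b' := 0) (by simp) (q * -y) (y ^ 2)
  simp only [zero_mul, qPochInf_zero, div_one, qBinCoeff_mul, qBinCoeff_left_zero] at h
  have h1 : ∀ m, q ^ m * qPoch (-q) q (m + i) / (qPoch q q m * qPoch q q (m + (2 * i + 1)))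
      = q ^ m * qPoch (-y) q m / qPoch q q m * qPochInf (y ^ 2 * q ^ m) q *
        (qPoch (-q) q i * (qPochInf q q)⁻¹) := fun m => by
    rw [div_mul_eq_div_div, div_eq_mul_inv, inv_qPoch_self_add hq, qPoch_neg_self_add, e]
    ring
  have h2 : ∀ r, (-1) ^ r * q ^ r.choose 2 * (y ^ 2) ^ r / qPoch q q r *
        (qPochInf (q * -y * q ^ r) q / qPochInf (q * q ^ r) q)
      = (-1) ^ r * q ^ r.choose 2 * (y ^ 2) ^ r / qPoch (-y) q (r + 1) *
        (qPochInf (-y) q * (qPochInf q q)⁻¹) := fun r => by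
    have h3 := qPoch_ne_zero_of_norm_lt hq hq r
    have h4 := qPoch_ne_zero_of_norm_lt hq hny (r + 1)
    rw [← pow_succ', div_eq_mul_inv (qPochInf _ _), inv_qPochInf_self hq,
      qPochInf_eq_mul hq (-y) (r + 1), show q * -y * q ^ r = -y * q ^ (r + 1) by ring]
    generalize qPochInf (-y * q ^ (r + 1)) q = u
    field_simp
  simp only [h1, tsum_mul_right, h, h2, hneg]
  ring

/-- With `y = q^(i+1)`, Heine for `b = 0`, `a = b' = -y`, `a' = y²` leaves `(-y; q)_∞ ∑ (-y)^r / (q;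
q)_r = 1`. -/
theorem tsum_pow_choose_two_mul_qPoch_neg_div (hq : ‖q‖ < 1) (i : ℕ) :
    ∑' m, q ^ (m.choose 2 + m * (i + 1)) * qPoch (-q) q (m + i) /
        (qPoch q q m * qPoch q q (m + (2 * i + 1)))
      = qPochInf (-q) q / qPochInf q q := by
  have hy := norm_pow_succ_lt_one hq i
  have e : q ^ (2 * i + 1 + 1) = (q ^ (i + 1)) ^ 2 := by ring
  have e' : ∀ m, q ^ (m.choose 2 + m * (i + 1)) = q ^ m.choose 2 * (q ^ (i + 1)) ^ m :=
    fun m => by ring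
  have hneg : qPochInf (-q) q = qPoch (-q) q i * qPochInf (-q ^ (i + 1)) q := by
    rw [qPochInf_eq_mul hq (-q) i, neg_mul, ← pow_succ']
  set y := q ^ (i + 1) with hy'
  have hny : ‖-y‖ < 1 := by simpa using hy
  have h0 := qPochInf_ne_zero_of_norm_lt hq hny
  have h := heine_symm hq (b := 0) (by simp) hny (-y) (-y * -y)
  simp only [zero_mul, qPochInf_zero, div_one, qBinCoeff_mul, qBinCoeff_left_zero] at h
  have h1 : ∀ m, q ^ (m.choose 2 + m * (i + 1)) * qPoch (-q) q (m + i) /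
        (qPoch q q m * qPoch q q (m + (2 * i + 1)))
      = (-1) ^ m * q ^ m.choose 2 * (-y) ^ m / qPoch q q m *
        (qPochInf (-y * -y * q ^ m) q / qPochInf (-y * q ^ m) q) *
        (qPochInf (-q) q * (qPochInf q q)⁻¹) := fun m => by
    have h3 : (-1 : ℂ) ^ m * (-1) ^ m = 1 := by rw [← mul_pow]; simp
    have h4 := qPochInf_ne_zero_of_norm_lt hq (norm_mul_pow_lt_one hq hny m)
    rw [div_mul_eq_div_div, div_eq_mul_inv, inv_qPoch_self_add hq, qPoch_neg_self_add, e, e',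
      ← hy', hneg, qPochInf_eq_mul hq (-y) m, neg_pow y m, show -y * -y = y ^ 2 by ring]
    generalize qPochInf (-y * q ^ m) q = u at h4 ⊢
    rw [mul_mul_mul_comm, ← mul_assoc _ _ (y ^ m), mul_right_comm ((-1 : ℂ) ^ m), h3]
    field_simp
  have h2 : ∀ r, (-y) ^ r * qPoch (-y) q r / qPoch q q r * qPochInf (-y * q ^ r) q
      = qBinCoeff (-y) 0 q r * qPochInf (-y) q := fun r => by
    rw [qBinCoeff_right_zero, qPochInf_eq_mul hq (-y) r]
    ring
  simp only [h1, tsum_mul_right, h, h2, tsum_qBinCoeff hq hny, qPochInf_zero]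
  rw [one_div, inv_mul_cancel₀ h0, one_mul, div_eq_mul_inv]

end GroupC

/-! ### Inner sums for E2 and E4. -/

section GroupE

variable {q : ℂ}

theorem hasSum_quadratic_qTheta (hq : ‖q‖ < 1) (x : ℂ) :
    HasSum (fun n : ℕ => (-1) ^ n * q ^ (2 * n.choose 2 + n) * x ^ n * (1 - q ^ (2 * n + 1)))
      (qTheta (q * x) (q ^ 2) - q * qTheta (q ^ 3 * x) (q ^ 2)) := by
  have h2 := norm_sq_lt_one hq
  refine hasSum_of_eq ((hasSum_qTheta h2 _).sub ((hasSum_qTheta h2 _).mul_left q)) (fun n => ?_) rfl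
  ring

theorem summable_qPoch_mul_pow_div_qPoch (hq : ‖q‖ < 1) {s x : ℂ} (hs : ‖s‖ < 1) (hx : ‖x‖ < 1) :
    Summable fun r : ℕ => qPoch (-s) q r * x ^ r / qPoch s q (r + 1) := by
  obtain ⟨C, hC⟩ := exists_norm_inv_qPoch_le hq hs
  obtain ⟨D, hD⟩ := exists_norm_qPoch_le hq (-s)
  have hD0 := (norm_nonneg _).trans (hD 0)
  refine Summable.of_norm_bounded (g := fun r => D * ‖x‖ ^ r * C)
    (((summable_geometric_of_lt_one (norm_nonneg x) hx).mul_left D).mul_right C) fun r => ?_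
  rw [div_eq_mul_inv, norm_mul, norm_mul, norm_pow]
  gcongr
  · exact hD _
  · exact hC _

/-- Summing the cleared term ratio of the left series relates it to the series with an extra `q^r`,
which is the sum of `tsum_qPoch_mul_pow_div_qPoch` at `s q`. -/
theorem one_add_mul_tsum_qPoch_div (hq : ‖q‖ < 1) {s : ℂ} (hs : ‖s‖ < 1) :
    (1 + s) * ∑' r : ℕ, qPoch (-(s * q)) q r * (-s) ^ r / qPoch (s * q) q (r + 1)
      = 1 + s * q * (1 - s) *
        ∑' r : ℕ, qPoch (-(s * q)) q r * (-(s * q)) ^ r / qPoch (s * q) q (r + 1) := by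
  have hsq : ‖s * q‖ < 1 := by simpa using norm_mul_pow_lt_one hq hs 1
  have hP := qPoch_ne_zero_of_norm_lt hq hsq
  have hne : ∀ r, 1 - s * q * q ^ r ≠ 0 := fun r =>
    sub_ne_zero.2 (mul_pow_ne_one hq hsq r).symm
  have hb := summable_qPoch_mul_pow_div_qPoch hq hsq (x := -s) (by simpa using hs)
  have hb' := summable_qPoch_mul_pow_div_qPoch hq hsq (x := -(s * q)) (by simpa using hsq)
  set b : ℕ → ℂ := fun r => qPoch (-(s * q)) q r * (-s) ^ r / qPoch (s * q) q (r + 1) with hbdef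
  have e : (fun r : ℕ => qPoch (-(s * q)) q r * (-(s * q)) ^ r / qPoch (s * q) q (r + 1))
      = fun r => q ^ r * b r := by
    funext r
    simp only [hbdef]
    ring
  rw [e] at hb' ⊢
  have hb0 : b 0 * (1 - s * q) = 1 := by
    have := hne 0
    simp only [hbdef, pow_zero, qPoch_succ, qPoch_zero, mul_one, one_mul] at this ⊢
    exact div_mul_cancel₀ 1 this
  have hrec : ∀ r, b (r + 1) - s * q * (q ^ (r + 1) * b (r + 1))
      = -s * b r - s ^ 2 * q * (q ^ r * b r) := fun r => by
    have h1 := hne (r + 1)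
    have h2 := hP (r + 1)
    simp only [hbdef, qPoch_succ (s * q) q (r + 1), qPoch_succ (-(s * q)) q r]
    field_simp
    ring
  have hsum := tsum_congr (L := .unconditional ℕ) hrec
  rw [((summable_nat_add_iff 1).2 hb).tsum_sub (((summable_nat_add_iff 1).2 hb').mul_left _),
    (hb.mul_left (-s)).tsum_sub (hb'.mul_left _), tsum_mul_left, tsum_mul_left,
    tsum_mul_left] at hsum
  have h1 := hb.tsum_eq_zero_add
  have h2 := hb'.tsum_eq_zero_add
  rw [pow_zero, one_mul] at h2
  linear_combination hb0 + hsum + h1 - s * q * h2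

theorem tsum_qPoch_mul_pow_div_qPoch_rec (hq : ‖q‖ < 1) {s : ℂ} (hs : ‖s‖ < 1) :
    ∑' r : ℕ, qPoch (-s) q r * (-s) ^ r / qPoch s q (r + 1)
      = 1 - q * s ^ 2 *
        ∑' r : ℕ, qPoch (-(s * q)) q r * (-(s * q)) ^ r / qPoch (s * q) q (r + 1) := by
  have hsq : ‖s * q‖ < 1 := by simpa using norm_mul_pow_lt_one hq hs 1
  have hne : 1 - s ≠ 0 := sub_ne_zero.2 fun h => by
    rw [← h, norm_one] at hs
    exact lt_irrefl _ hs
  have hP := qPoch_ne_zero_of_norm_lt hq hsq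
  have ha := summable_qPoch_mul_pow_div_qPoch hq hs (x := -s) (by simpa using hs)
  have h1 : ∀ r, qPoch (-s) q (r + 1) * (-s) ^ (r + 1) / qPoch s q (r + 1 + 1)
      = -s * (1 + s) / (1 - s) *
        (qPoch (-(s * q)) q r * (-s) ^ r / qPoch (s * q) q (r + 1)) := fun r => by
    have h2 := hP (r + 1)
    rw [qPoch_succ' (-s), qPoch_succ' s, neg_mul, sub_neg_eq_add]
    field_simp
    ring
  have h2 := one_add_mul_tsum_qPoch_div hq hs
  rw [ha.tsum_eq_zero_add]
  simp only [h1, tsum_mul_left]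
  simp only [pow_zero, qPoch_succ s q 0, qPoch_zero, mul_one, one_mul]
  rw [mul_div_right_comm, mul_assoc, h2]
  field_simp
  ring

/-- A case of the Rogers–Fine identity. -/
theorem tsum_qPoch_mul_pow_div_qPoch (hq : ‖q‖ < 1) {s : ℂ} (hs : ‖s‖ < 1) :
    ∑' r : ℕ, qPoch (-s) q r * (-s) ^ r / qPoch s q (r + 1) = qTheta (q * s ^ 2) (q ^ 2) := by
  have h2 := norm_sq_lt_one hq
  obtain ⟨C, hC⟩ := exists_norm_inv_qPoch_mul_pow_le hq hs
  obtain ⟨D, hD⟩ := exists_norm_qPoch_mul_pow_le hq (a := -s) (by simpa using hs)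
  have hD0 := (norm_nonneg _).trans (hD 0 0)
  have hsj := norm_mul_pow_lt_one hq hs
  set f : ℂ → ℂ := fun s => ∑' r : ℕ, qPoch (-s) q r * (-s) ^ r / qPoch s q (r + 1) with hf
  have hsmall : ∀ c : ℂ, ‖c‖ < 1 → ∀ j, ‖c * (s * q ^ j) ^ 2‖ ≤ ‖c‖ := fun c hc j => by
    rw [norm_mul, norm_pow]
    exact mul_le_of_le_one_right (norm_nonneg _) (pow_le_one₀ (norm_nonneg _) (hsj j).le)
  have hfC : ∀ j, ‖f (s * q ^ j)‖ ≤ ∑' r : ℕ, D * ‖s‖ ^ r * C := fun j => by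
    refine tsum_of_norm_bounded (((summable_geometric_of_lt_one (norm_nonneg s) hs).mul_left
      D).mul_right C).hasSum fun r => ?_
    rw [div_eq_mul_inv, norm_mul, norm_mul, norm_pow, norm_neg, ← neg_mul]
    gcongr
    · exact hD j r
    · rw [norm_mul, norm_pow]
      exact mul_le_of_le_one_right (norm_nonneg _) (pow_le_one₀ (norm_nonneg _) hq.le)
    · exact hC j (r + 1)
  -- Both sides satisfy `F(s) = 1 - q s² F(s q)`.
  have hz := eq_zero_of_eq_mul_succ
    (δ := fun j => f (s * q ^ j) - qTheta (q * (s * q ^ j) ^ 2) (q ^ 2))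
    (c := fun j => -(q * (s * q ^ j) ^ 2)) (norm_nonneg q) hq
    (fun j => by
      have h3 := tsum_qPoch_mul_pow_div_qPoch_rec hq (hsj j)
      have h4 := qTheta_eq_one_sub h2 (q * (s * q ^ j) ^ 2)
      rw [show q ^ 2 * (q * (s * q ^ j) ^ 2) = q * (s * q ^ (j + 1)) ^ 2 by ring] at h4
      rw [mul_assoc s, ← pow_succ] at h3
      simp only [hf] at h3 ⊢
      linear_combination h3 - h4)
    (fun j => by
      rw [norm_neg]
      exact hsmall q hq j)
    (fun j => (norm_sub_le _ _).trans
      (add_le_add (hfC j) (norm_qTheta_le h2 ((hsmall q hq j).trans hq.le)))) 0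
  simpa [sub_eq_zero] using hz

theorem one_add_mul_tsum_qPoch_mul_one_sub (hq : ‖q‖ < 1) {s : ℂ} (hs : ‖s‖ < 1) :
    (1 + s) * ∑' r : ℕ, qPoch (-(s * q)) q r * (-s) ^ r * (1 - q ^ (r + 1)) /
        qPoch (s * q) q (r + 1)
      = qTheta (q * s ^ 2) (q ^ 2) - q * qTheta (q ^ 3 * s ^ 2) (q ^ 2) := by
  have hsq : ‖s * q‖ < 1 := by simpa using norm_mul_pow_lt_one hq hs 1
  have hb := summable_qPoch_mul_pow_div_qPoch hq hsq (x := -s) (by simpa using hs)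
  have hb' := summable_qPoch_mul_pow_div_qPoch hq hsq (x := -(s * q)) (by simpa using hsq)
  have e : ∀ r : ℕ, qPoch (-(s * q)) q r * (-s) ^ r * (1 - q ^ (r + 1)) / qPoch (s * q) q (r + 1)
      = qPoch (-(s * q)) q r * (-s) ^ r / qPoch (s * q) q (r + 1)
        - q * (qPoch (-(s * q)) q r * (-(s * q)) ^ r / qPoch (s * q) q (r + 1)) := fun r => by
    ring
  have h1 := one_add_mul_tsum_qPoch_div hq hs
  have h2 := tsum_qPoch_mul_pow_div_qPoch_rec hq hs
  have h3 := tsum_qPoch_mul_pow_div_qPoch hq hsq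
  rw [tsum_qPoch_mul_pow_div_qPoch hq hs] at h2
  rw [show q * (s * q) ^ 2 = q ^ 3 * s ^ 2 by ring] at h3
  simp only [e]
  rw [hb.tsum_sub (hb'.mul_left q), tsum_mul_left]
  rw [h3] at h1 h2 ⊢
  linear_combination h1 - h2

theorem qPoch_sq_eq_mul (s q : ℂ) (n : ℕ) :
    qPoch (s ^ 2) (q ^ 2) n = qPoch s q n * qPoch (-s) q n := by
  rw [qPoch, qPoch, qPoch, ← prod_mul_distrib]
  refine prod_congr rfl fun j _ => ?_
  ring

/-- A square root `s` of `q^(2i+1)` factors `(q^(2i+1); q²)_m` as `(s; q)_m (-s; q)_m`, so that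
base-`q` transformations apply. Either root serves, since the final formulas involve only `s²`. -/
theorem exists_sq_eq_pow (hq : ‖q‖ < 1) (i : ℕ) :
    ∃ s : ℂ, s ^ 2 = q ^ (2 * i + 1) ∧ ‖s‖ < 1 := by
  obtain ⟨p, hp⟩ := IsAlgClosed.exists_pow_nat_eq (q ^ (2 * i + 1)) two_pos
  refine ⟨p, hp, ?_⟩
  have h : ‖p‖ ^ 2 < 1 := by
    rw [← norm_pow, hp]
    exact norm_pow_succ_lt_one hq _
  exact (pow_lt_one_iff_of_nonneg (norm_nonneg _) two_ne_zero).1 h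

theorem qPoch_odd_add (q : ℂ) (m i : ℕ) {s : ℂ} (hs : s ^ 2 = q ^ (2 * i + 1)) :
    qPoch q (q ^ 2) (m + i) = qPoch q (q ^ 2) i * (qPoch s q m * qPoch (-s) q m) := by
  rw [add_comm, qPoch_add, ← qPoch_sq_eq_mul, hs]
  congr 2
  ring

theorem qPochInf_odd_eq (hq : ‖q‖ < 1) {i : ℕ} {s : ℂ} (hs : s ^ 2 = q ^ (2 * i + 1)) :
    qPochInf q (q ^ 2) = qPoch q (q ^ 2) i * (1 - q ^ (2 * i + 1)) *
      (qPochInf (s * q) q * qPochInf (-(s * q)) q) := by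
  rw [qPochInf_mul_neg hq, mul_pow, hs, qPochInf_eq_mul (norm_sq_lt_one hq) q (i + 1), qPoch_succ]
  congr 2 <;> ring

/-- Heine for `b = -q`, `a = -q s`, `b' = -s`, `a' = q s²` gives a series summable by the
`q`-binomial theorem. -/
theorem tsum_neg_pow_mul_qPoch_odd_div (hq : ‖q‖ < 1) (i : ℕ) :
    (1 - q ^ (2 * i + 1)) * ∑' m, (-q) ^ m * qPoch q (q ^ 2) (m + i) /
        (qPoch q q m * qPoch q q (m + (2 * i + 1)))
      = qPochInf q (q ^ 2) / (qPochInf q q * qPochInf (-q) q) := by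
  obtain ⟨s, hs2, hs⟩ := exists_sq_eq_pow hq i
  have hns : ‖-s‖ < 1 := by simpa using hs
  have hnq : ‖-q‖ < 1 := by simpa using hq
  have h0 := qPochInf_ne_zero_of_norm_lt hq hns
  have h0' := qPochInf_ne_zero_of_norm_lt hq hnq
  have e : q ^ (2 * i + 1 + 1) = -s * -(s * q) := by
    rw [pow_succ, ← hs2]
    ring
  have h := heine_symm hq hnq hns (-q * s) (-s * -(s * q))
  simp only [qBinCoeff_mul] at h
  have h1 : ∀ m, (-q) ^ m * qPoch q (q ^ 2) (m + i) /
        (qPoch q q m * qPoch q q (m + (2 * i + 1)))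
      = (-q) ^ m * qPoch s q m / qPoch q q m *
        (qPochInf (-s * -(s * q) * q ^ m) q / qPochInf (-s * q ^ m) q) *
        (qPoch q (q ^ 2) i * qPochInf (-s) q * (qPochInf q q)⁻¹) := fun m => by
    have h4 := qPochInf_ne_zero_of_norm_lt hq (norm_mul_pow_lt_one hq hns m)
    rw [div_mul_eq_div_div, div_eq_mul_inv, inv_qPoch_self_add hq, qPoch_odd_add q m i hs2, e,
      qPochInf_eq_mul hq (-s) m]
    generalize qPochInf (-s * q ^ m) q = u at h4 ⊢
    field_simp
  have h2 : ∀ r, (-s) ^ r * qPoch (-(s * q)) q r / qPoch q q r *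
        (qPochInf (-q * s * q ^ r) q / qPochInf (-q * q ^ r) q)
      = qBinCoeff (-s) (-s * -q) q r * (qPochInf (-(s * q)) q / qPochInf (-q) q) := fun r => by
    have h4 := qPochInf_ne_zero_of_norm_lt hq (norm_mul_pow_lt_one hq hnq r)
    have h5 := qPoch_ne_zero_of_norm_lt hq hnq r
    rw [qBinCoeff_mul, qPochInf_eq_mul hq (-q) r, qPochInf_eq_mul hq (-(s * q)) r,
      show -q * s * q ^ r = -(s * q) * q ^ r by ring]
    generalize qPochInf (-q * q ^ r) q = u at h4 ⊢
    generalize qPochInf (-(s * q) * q ^ r) q = v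
    field_simp
  simp only [h1, tsum_mul_right, h, h2, tsum_qBinCoeff hq hns]
  rw [qPochInf_odd_eq hq hs2, show -s * -q = s * q by ring]
  field_simp

/-- The same transformation with `b = q²`, `a = q² s` leads to the series of
`one_add_mul_tsum_qPoch_mul_one_sub`. -/
theorem tsum_pow_two_mul_mul_qPoch_odd_div (hq : ‖q‖ < 1) (i : ℕ) :
    (1 - q ^ (2 * i + 1)) * ∑' m, q ^ (2 * m) * qPoch q (q ^ 2) (m + i) /
        (qPoch q q m * qPoch q q (m + (2 * i + 1)))
      = qPochInf q (q ^ 2) / qPochInf q q ^ 2 *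
        (qTheta (q * q ^ (2 * i + 1)) (q ^ 2) - q * qTheta (q ^ 3 * q ^ (2 * i + 1)) (q ^ 2)) := by
  obtain ⟨s, hs2, hs⟩ := exists_sq_eq_pow hq i
  have hns : ‖-s‖ < 1 := by simpa using hs
  have hsq : ‖s * q‖ < 1 := by simpa using norm_mul_pow_lt_one hq hs 1
  have e : q ^ (2 * i + 1 + 1) = -s * -(s * q) := by
    rw [pow_succ, ← hs2]
    ring
  have h := heine_symm hq (norm_sq_lt_one hq) hns (q ^ 2 * s) (-s * -(s * q))
  simp only [qBinCoeff_mul] at h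
  have h1 : ∀ m, q ^ (2 * m) * qPoch q (q ^ 2) (m + i) /
        (qPoch q q m * qPoch q q (m + (2 * i + 1)))
      = (q ^ 2) ^ m * qPoch s q m / qPoch q q m *
        (qPochInf (-s * -(s * q) * q ^ m) q / qPochInf (-s * q ^ m) q) *
        (qPoch q (q ^ 2) i * qPochInf (-s) q * (qPochInf q q)⁻¹) := fun m => by
    have h4 := qPochInf_ne_zero_of_norm_lt hq (norm_mul_pow_lt_one hq hns m)
    rw [div_mul_eq_div_div, div_eq_mul_inv, inv_qPoch_self_add hq, qPoch_odd_add q m i hs2, e,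
      qPochInf_eq_mul hq (-s) m, pow_mul]
    generalize qPochInf (-s * q ^ m) q = u at h4 ⊢
    field_simp
  have h2 : ∀ r, (-s) ^ r * qPoch (-(s * q)) q r / qPoch q q r *
        (qPochInf (q ^ 2 * s * q ^ r) q / qPochInf (q ^ 2 * q ^ r) q)
      = qPoch (-(s * q)) q r * (-s) ^ r * (1 - q ^ (r + 1)) / qPoch (s * q) q (r + 1) *
        (qPochInf (s * q) q * (qPochInf q q)⁻¹) := fun r => by
    have h4 := qPoch_ne_zero_of_norm_lt hq hsq (r + 1)
    have h5 := qPoch_ne_zero_of_norm_lt hq hq r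
    rw [← pow_add, show 2 + r = r + 1 + 1 by ring, div_eq_mul_inv (qPochInf _ _),
      inv_qPochInf_self hq, qPoch_self_succ, qPochInf_eq_mul hq (s * q) (r + 1),
      show q ^ 2 * s * q ^ r = s * q * q ^ (r + 1) by ring]
    generalize qPochInf (s * q * q ^ (r + 1)) q = v
    field_simp
  have h3 := one_add_mul_tsum_qPoch_mul_one_sub hq hs
  rw [hs2] at h3
  simp only [h1, tsum_mul_right, h, h2]
  rw [← h3, qPochInf_odd_eq hq hs2, qPochInf_eq_one_sub_mul hq (-s), sub_neg_eq_add, neg_mul]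
  ring

end GroupE

/-! ### Factorizations that simplify `c n (q; q)_(2n)`. -/

section Numerators

variable {q : ℂ}

theorem qPoch_self_two_mul (q : ℂ) (n : ℕ) :
    qPoch q q (2 * n) = qPoch q (q ^ 2) n * (qPoch q q n * qPoch (-q) q n) := by
  rw [qPoch_two_mul, ← pow_two, ← qPoch_sq_eq_mul]

theorem qPochInf_odd_eq_mul (hq : ‖q‖ < 1) (n : ℕ) :
    qPochInf q (q ^ 2) = qPoch q (q ^ 2) n * qPochInf (q ^ (2 * n + 1)) (q ^ 2) := by
  rw [qPochInf_eq_mul (norm_sq_lt_one hq) q n]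
  congr 2
  ring

theorem qPochInf_even_eq_mul (hq : ‖q‖ < 1) (n : ℕ) :
    qPochInf (q ^ 2) (q ^ 2)
      = qPoch q q n * qPoch (-q) q n * qPochInf (q ^ (2 * n + 2)) (q ^ 2) := by
  rw [qPochInf_eq_mul (norm_sq_lt_one hq) (q ^ 2) n, qPoch_sq_eq_mul]
  congr 2
  ring

end Numerators

/-! ### Reindexing of sums and exponents. -/

section Reindex

theorem hasSum_pnat_of_hasSum {F : ℕ+ → ℂ} {f : ℕ → ℂ} {a : ℂ} (h : HasSum f a)
    (hF : ∀ i : ℕ, F i.succPNat = f i) : HasSum F a := by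
  rw [← Equiv.pnatEquivNat.symm.hasSum_iff]
  exact hasSum_of_eq h hF rfl

theorem hasSum_pnat_prod_of_hasSum {F : ℕ+ × ℕ → ℂ} {f : ℕ × ℕ → ℂ} {a : ℂ} (h : HasSum f a)
    (hF : ∀ i n : ℕ, F (i.succPNat, n) = f (i, n)) : HasSum F a := by
  rw [← (Equiv.prodCongr Equiv.pnatEquivNat (Equiv.refl ℕ)).symm.hasSum_iff]
  exact hasSum_of_eq h (fun p => hF p.1 p.2) rfl

theorem hasSum_int_of_hasSum_add {F : ℤ → ℂ} {f g : ℕ → ℂ} {a : ℂ}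
    (h : HasSum (fun i => f i + g i) a) (hf : Summable f) (hg : Summable g)
    (hFf : ∀ i : ℕ, F i = f i) (hFg : ∀ i : ℕ, F (-((i : ℤ) + 1)) = g i) : HasSum F a := by
  have h1 : HasSum (fun i : ℕ => F i) (∑' i, f i) := hasSum_of_eq hf.hasSum hFf rfl
  have h2 : HasSum (fun i : ℕ => F (-((i : ℤ) + 1))) (∑' i, g i) := hasSum_of_eq hg.hasSum hFg rfl
  rw [h.unique (hf.hasSum.add hg.hasSum)]
  exact h1.of_nat_of_neg_add_one h2

theorem hasSum_prod_of_rows {u : ℕ → ℂ} {v : ℕ → ℕ → ℂ} {V : ℕ → ℂ} {a b : ℕ → ℝ} {s : ℂ}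
    (ha : Summable a) (hb : Summable b) (ha0 : ∀ i, 0 ≤ a i) (hb0 : ∀ n, 0 ≤ b n)
    (hle : ∀ i n, ‖u i * v i n‖ ≤ a i * b n) (hrow : ∀ i, HasSum (v i) (V i))
    (h : HasSum (fun i => u i * V i) s) : HasSum (fun p : ℕ × ℕ => u p.1 * v p.1 p.2) s := by
  have hs : Summable fun p : ℕ × ℕ => u p.1 * v p.1 p.2 :=
    Summable.of_norm_bounded (ha.mul_of_nonneg hb ha0 hb0) fun p => hle p.1 p.2
  have h1 := hs.hasSum.prod_fiberwise fun i => (hrow i).mul_left (u i)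
  rw [h.unique h1]
  exact hs.hasSum

theorem two_mul_choose_two (n : ℕ) : 2 * (n.choose 2 : ℤ) = n * (n - 1) := by
  induction n with
  | zero => simp
  | succ n ih =>
    rw [Nat.choose_succ_succ', Nat.choose_one_right]
    push_cast
    linear_combination ih

theorem sq_eq_two_mul_choose_two_add (n : ℕ) : n ^ 2 = 2 * n.choose 2 + n := by
  zify
  linear_combination -two_mul_choose_two n

theorem zpow_eq_pow_of_eq (q : ℂ) {e : ℤ} {n : ℕ} (h : e = n) : q ^ e = q ^ n := by
  rw [h, zpow_natCast]

theorem ediv_two_of_eq {a b : ℤ} (h : a = 2 * b) : a / 2 = b := by omega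

end Reindex

/-! ### Symmetry of `zFactor` and the general expansion. -/

section General

variable {q z : ℂ}

/-- The symmetry `k ↦ 1 - k`, which folds the bilateral series of A5, A7 and C5 onto the naturals.
-/
theorem zFactor_neg (hz : z ≠ 0) (i : ℕ) : zFactor z (-(i : ℤ)) = zFactor z ((i : ℤ) + 1) := by
  have h1 : z ^ (i : ℤ) ≠ 0 := zpow_ne_zero _ hz
  simp only [zFactor, sub_eq_add_neg, zpow_add₀ hz, zpow_neg, neg_add, neg_neg, zpow_one]
  field_simp
  ring

theorem summable_zFactor_mul (hq : ‖q‖ < 1) (hz : z ≠ 0) {w : ℕ → ℂ} {e : ℕ → ℕ}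
    (hw : ∀ i, ‖w i‖ ≤ 1) (he : ∀ i, i.choose 2 ≤ e i) :
    Summable fun i : ℕ => zFactor z ((i : ℤ) + 1) * (w i * q ^ e i) := by
  refine Summable.of_norm_bounded (summable_pow_choose_two_mul_zFactor hq hz) fun i => ?_
  rw [norm_mul, mul_comm, norm_mul, norm_pow]
  refine mul_le_mul_of_nonneg_right ?_ (norm_nonneg _)
  refine (mul_le_of_le_one_left (by positivity) (hw i)).trans ?_
  exact pow_le_pow_of_le_one (norm_nonneg _) hq.le (he i)

theorem sptCrank_expansion (hq : ‖q‖ < 1) (hz : z ≠ 0)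
    (hpole : ∀ n : ℕ, 1 ≤ n → z * q ^ n ≠ 1 ∧ z⁻¹ * q ^ n ≠ 1) {c : ℕ → ℂ} (e : ℕ → ℕ)
    (w : ℕ → ℂ) (he : ∀ n, n ≤ e n) (hw : ∃ C, ∀ n, ‖w n‖ ≤ C)
    (hcd : ∀ n, c n * qPoch q q (2 * n) = q ^ e n * w n) {H : ℕ → ℂ}
    (hH : ∀ i, (-1) ^ i * q ^ i.choose 2 * (1 - q ^ (2 * i + 1)) *
      ∑' m, q ^ e (m + i) * w (m + i) / (qPoch q q m * qPoch q q (m + (2 * i + 1))) = H i) :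
    (Summable fun n : ℕ+ => sptCrankTerm c z q n) ∧
      HasSum (fun i : ℕ => zFactor z ((i : ℤ) + 1) * H i)
        (sptPrefactor z q * sptCrankSeries c z q) := by
  obtain ⟨C, hC⟩ := hw
  have hd : ∀ n, ‖q ^ e n * w n‖ ≤ C * ‖q‖ ^ n := fun n => by
    rw [norm_mul, norm_pow, mul_comm]
    exact mul_le_mul (hC n) (pow_le_pow_of_le_one (norm_nonneg _) hq.le (he n)) (by positivity)
      ((norm_nonneg _).trans (hC n))
  refine ⟨summable_sptCrankTerm hq hpole hcd hd, ?_⟩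
  exact hasSum_of_eq (hasSum_sptPrefactor_mul hq hz hpole hcd hd) (fun i => by rw [hH]) rfl

end General

/-! ### The eight expansions in `zFactor z (i+1)`. -/

section Expansions

variable {q z : ℂ}

theorem sptA1_expansion (hq : ‖q‖ < 1) (hz : z ≠ 0)
    (hpole : ∀ n : ℕ, 1 ≤ n → z * q ^ n ≠ 1 ∧ z⁻¹ * q ^ n ≠ 1) :
    (Summable fun n : ℕ+ => sptCrankTerm (numA1 q) z q n) ∧
      HasSum (fun i : ℕ => zFactor z ((i : ℤ) + 1) * ((-1) ^ i * q ^ (i + 1).choose 2 *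
          ((1 - q ^ (2 * i + 1)) * qTheta (q * q ^ (2 * i + 1)) q) / qPochInf q q))
        (sptPrefactor z q * sptA1 z q) := by
  have h0 := qPochInf_ne_zero_of_norm_lt hq hq
  refine sptCrank_expansion hq hz hpole (fun n => n) (fun _ => qPochInf q q) (fun n => le_rfl)
    ⟨_, fun _ => le_rfl⟩ (fun n => ?_) fun i => ?_
  · rw [numA1, qPochInf_self_eq hq (2 * n)]
    ring
  · have h : ∀ m, q ^ (m + i) * qPochInf q q / (qPoch q q m * qPoch q q (m + (2 * i + 1)))
        = q ^ m / (qPoch q q m * qPoch q q (m + (2 * i + 1))) * (q ^ i * qPochInf q q) :=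
      fun m => by ring
    simp only [h, tsum_mul_right, tsum_pow_div_qPoch hq]
    rw [pow_choose_two_succ, pow_succ' q (2 * i + 1)]
    field_simp

theorem sptA3_expansion (hq : ‖q‖ < 1) (hz : z ≠ 0)
    (hpole : ∀ n : ℕ, 1 ≤ n → z * q ^ n ≠ 1 ∧ z⁻¹ * q ^ n ≠ 1) :
    (Summable fun n : ℕ+ => sptCrankTerm (numA3 q) z q n) ∧
      HasSum (fun i : ℕ => zFactor z ((i : ℤ) + 1) * ((-1) ^ i * q ^ (i.choose 2 + 2 * i) *
          ((1 - q ^ (2 * i + 1)) * (qTheta (q * q ^ (2 * i + 1)) q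
            - q * qTheta (q ^ 2 * q ^ (2 * i + 1)) q)) / qPochInf q q))
        (sptPrefactor z q * sptA3 z q) := by
  have h0 := qPochInf_ne_zero_of_norm_lt hq hq
  refine sptCrank_expansion hq hz hpole (fun n => 2 * n) (fun _ => qPochInf q q)
    (fun n => by omega) ⟨_, fun _ => le_rfl⟩ (fun n => ?_) fun i => ?_
  · rw [numA3, qPochInf_self_eq hq (2 * n)]
    ring
  · have h : ∀ m, q ^ (2 * (m + i)) * qPochInf q q / (qPoch q q m * qPoch q q (m + (2 * i + 1)))
        = q ^ (2 * m) / (qPoch q q m * qPoch q q (m + (2 * i + 1))) *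
          (q ^ (2 * i) * qPochInf q q) := fun m => by ring
    simp only [h, tsum_mul_right, tsum_pow_two_mul_div_qPoch hq]
    rw [pow_add q (i.choose 2), pow_succ' q (2 * i + 1), ← pow_add q 2,
      show 2 + (2 * i + 1) = 2 * i + 1 + 2 by ring]
    field_simp

theorem sptA5_expansion (hq : ‖q‖ < 1) (hz : z ≠ 0)
    (hpole : ∀ n : ℕ, 1 ≤ n → z * q ^ n ≠ 1 ∧ z⁻¹ * q ^ n ≠ 1) :
    (Summable fun n : ℕ+ => sptCrankTerm (numA5 q) z q n) ∧
      HasSum (fun i : ℕ => zFactor z ((i : ℤ) + 1) *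
          ((-1) ^ i * q ^ (3 * i.choose 2 + 2 * i) * (1 - q ^ (2 * i + 1))))
        (sptPrefactor z q * sptA5 z q) := by
  have h0 := qPochInf_ne_zero_of_norm_lt hq hq
  refine sptCrank_expansion hq hz hpole (fun n => n ^ 2 + n) (fun _ => qPochInf q q)
    (fun n => by omega) ⟨_, fun _ => le_rfl⟩ (fun n => ?_) fun i => ?_
  · rw [numA5, qPochInf_self_eq hq (2 * n)]
    ring
  · have h : ∀ m, q ^ ((m + i) ^ 2 + (m + i)) * qPochInf q q /
          (qPoch q q m * qPoch q q (m + (2 * i + 1)))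
        = q ^ (m ^ 2 + (2 * i + 1) * m) / (qPoch q q m * qPoch q q (m + (2 * i + 1))) *
          (q ^ (i ^ 2 + i) * qPochInf q q) := fun m => by ring
    simp only [h, tsum_mul_right, tsum_durfee hq]
    rw [sq_eq_two_mul_choose_two_add]
    field_simp
    ring

theorem sptA7_expansion (hq : ‖q‖ < 1) (hz : z ≠ 0)
    (hpole : ∀ n : ℕ, 1 ≤ n → z * q ^ n ≠ 1 ∧ z⁻¹ * q ^ n ≠ 1) :
    (Summable fun n : ℕ+ => sptCrankTerm (numA7 q) z q n) ∧
      HasSum (fun i : ℕ => zFactor z ((i : ℤ) + 1) *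
          ((-1) ^ i * q ^ (3 * i.choose 2 + i) * (1 - q ^ (4 * i + 2))))
        (sptPrefactor z q * sptA7 z q) := by
  have h0 := qPochInf_ne_zero_of_norm_lt hq hq
  refine sptCrank_expansion hq hz hpole (fun n => n ^ 2) (fun _ => qPochInf q q)
    (fun n => Nat.le_self_pow two_ne_zero n) ⟨_, fun _ => le_rfl⟩ (fun n => ?_) fun i => ?_
  · rw [numA7, qPochInf_self_eq hq (2 * n)]
    ring
  · have h : ∀ m, q ^ (m + i) ^ 2 * qPochInf q q / (qPoch q q m * qPoch q q (m + (2 * i + 1)))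
        = q ^ (m ^ 2 + 2 * i * m) / (qPoch q q m * qPoch q q (m + (2 * i + 1))) *
          (q ^ i ^ 2 * qPochInf q q) := fun m => by ring
    simp only [h, tsum_mul_right, tsum_durfee_succ hq]
    rw [sq_eq_two_mul_choose_two_add]
    field_simp
    ring

theorem exists_norm_const_mul_qPoch_le (hq : ‖q‖ < 1) (b a : ℂ) :
    ∃ C, ∀ n, ‖b * qPoch a q n‖ ≤ C := by
  obtain ⟨C, hC⟩ := exists_norm_qPoch_le hq a
  refine ⟨‖b‖ * C, fun n => ?_⟩
  rw [norm_mul]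
  exact mul_le_mul_of_nonneg_left (hC n) (norm_nonneg _)

theorem qPochInf_mul_qPoch_two_mul (hq : ‖q‖ < 1) (n : ℕ) :
    qPochInf (q ^ (2 * n + 1)) (q ^ 2) * qPochInf (q ^ (n + 1)) q * qPoch q q (2 * n)
      = qPochInf q (q ^ 2) * qPochInf q q * qPoch (-q) q n := by
  rw [qPoch_self_two_mul, qPochInf_odd_eq_mul hq n, qPochInf_self_eq hq n]
  ring

theorem sptC1_expansion (hq : ‖q‖ < 1) (hz : z ≠ 0)
    (hpole : ∀ n : ℕ, 1 ≤ n → z * q ^ n ≠ 1 ∧ z⁻¹ * q ^ n ≠ 1) :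
    (Summable fun n : ℕ+ => sptCrankTerm (numC1 q) z q n) ∧
      HasSum (fun i : ℕ => zFactor z ((i : ℤ) + 1) * ((-1) ^ i * q ^ (i + 1).choose 2 *
          (1 - q ^ (2 * i + 1)) * (qTheta (-(q * (q ^ (i + 1)) ^ 3)) (q ^ 3)
          - q ^ (i + 1) * qTheta (-(q ^ 2 * (q ^ (i + 1)) ^ 3)) (q ^ 3)) / qPochInf q q))
        (sptPrefactor z q * sptC1 z q) := by
  have h0 := qPochInf_ne_zero_of_norm_lt hq hq
  refine sptCrank_expansion hq hz hpole (fun n => n)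
    (fun n => qPochInf q (q ^ 2) * qPochInf q q * qPoch (-q) q n) (fun n => le_rfl)
    (exists_norm_const_mul_qPoch_le hq _ _) (fun n => ?_) fun i => ?_
  · rw [numC1, ← qPochInf_mul_qPoch_two_mul hq]
    ring
  · have h : ∀ m, q ^ (m + i) * (qPochInf q (q ^ 2) * qPochInf q q * qPoch (-q) q (m + i)) /
          (qPoch q q m * qPoch q q (m + (2 * i + 1)))
        = q ^ m * qPoch (-q) q (m + i) / (qPoch q q m * qPoch q q (m + (2 * i + 1))) *
          (q ^ i * (qPochInf q (q ^ 2) * qPochInf q q)) := fun m => by ring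
    simp only [h, tsum_mul_right, tsum_pow_mul_qPoch_neg_div hq]
    have h1 := qPochInf_neg_mul_odd hq
    rw [pow_choose_two_succ]
    generalize qTheta (-(q * (q ^ (i + 1)) ^ 3)) (q ^ 3) = s
    generalize qTheta (-(q ^ 2 * (q ^ (i + 1)) ^ 3)) (q ^ 3) = t
    generalize qPochInf (-q) q = u at h1 ⊢
    generalize qPochInf q (q ^ 2) = v at h1 ⊢
    field_simp
    linear_combination q ^ i.choose 2 * q ^ i * (1 - q ^ (2 * i + 1)) * (s - q ^ (i + 1) * t) * h1

theorem choose_two_add_succ (m i : ℕ) :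
    (m + i + 1).choose 2 = m.choose 2 + m * (i + 1) + (i + 1).choose 2 := by
  have h1 := two_mul_choose_two (m + i + 1)
  have h2 := two_mul_choose_two m
  have h3 := two_mul_choose_two (i + 1)
  zify
  push_cast at h1 h2 h3
  linarith

theorem sq_add_self_div_two (n : ℕ) : (n ^ 2 + n) / 2 = (n + 1).choose 2 := by
  have h : (n + 1).choose 2 = n + n.choose 2 := by
    rw [Nat.choose_succ_succ', Nat.choose_one_right]
  rw [sq_eq_two_mul_choose_two_add, h]
  omega

theorem sptC5_expansion (hq : ‖q‖ < 1) (hz : z ≠ 0)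
    (hpole : ∀ n : ℕ, 1 ≤ n → z * q ^ n ≠ 1 ∧ z⁻¹ * q ^ n ≠ 1) :
    (Summable fun n : ℕ+ => sptCrankTerm (numC5 q) z q n) ∧
      HasSum (fun i : ℕ => zFactor z ((i : ℤ) + 1) *
          ((-1) ^ i * q ^ i ^ 2 * (1 - q ^ (2 * i + 1))))
        (sptPrefactor z q * sptC5 z q) := by
  have h0 := qPochInf_ne_zero_of_norm_lt hq hq
  refine sptCrank_expansion hq hz hpole (fun n => (n + 1).choose 2)
    (fun n => qPochInf q (q ^ 2) * qPochInf q q * qPoch (-q) q n)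
    (fun n => by rw [Nat.choose_succ_succ', Nat.choose_one_right]; omega)
    (exists_norm_const_mul_qPoch_le hq _ _) (fun n => ?_) fun i => ?_
  · rw [numC5, sq_add_self_div_two, ← qPochInf_mul_qPoch_two_mul hq]
    ring
  · have h : ∀ m, q ^ (m + i + 1).choose 2 *
          (qPochInf q (q ^ 2) * qPochInf q q * qPoch (-q) q (m + i)) /
          (qPoch q q m * qPoch q q (m + (2 * i + 1)))
        = q ^ (m.choose 2 + m * (i + 1)) * qPoch (-q) q (m + i) /
          (qPoch q q m * qPoch q q (m + (2 * i + 1))) *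
          (q ^ (i + 1).choose 2 * (qPochInf q (q ^ 2) * qPochInf q q)) := fun m => by
      rw [choose_two_add_succ, pow_add]
      ring
    simp only [h, tsum_mul_right, tsum_pow_choose_two_mul_qPoch_neg_div hq]
    have h1 := qPochInf_neg_mul_odd hq
    rw [pow_choose_two_succ, sq_eq_two_mul_choose_two_add]
    generalize qPochInf (-q) q = u at h1 ⊢
    generalize qPochInf q (q ^ 2) = v at h1 ⊢
    field_simp
    linear_combination q ^ (2 * i.choose 2 + i) * (1 - q ^ (2 * i + 1)) * h1

theorem qPochInf_even_mul_qPoch_two_mul (hq : ‖q‖ < 1) (n : ℕ) :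
    qPochInf (q ^ (2 * n + 2)) (q ^ 2) * qPoch q q (2 * n)
      = qPochInf (q ^ 2) (q ^ 2) * qPoch q (q ^ 2) n := by
  rw [qPoch_self_two_mul, qPochInf_even_eq_mul hq n]
  ring

theorem sptE2_expansion (hq : ‖q‖ < 1) (hz : z ≠ 0)
    (hpole : ∀ n : ℕ, 1 ≤ n → z * q ^ n ≠ 1 ∧ z⁻¹ * q ^ n ≠ 1) :
    (Summable fun n : ℕ+ => sptCrankTerm (numE2 q) z q n) ∧
      HasSum (fun i : ℕ => zFactor z ((i : ℤ) + 1) *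
          (q ^ (i + 1).choose 2 * qPochInf q (q ^ 2)))
        (sptPrefactor z q * sptE2 z q) := by
  have h0 := qPochInf_ne_zero_of_norm_lt hq hq
  have h0' : qPochInf (-q) q ≠ 0 := qPochInf_ne_zero_of_norm_lt hq (by simpa using hq)
  obtain ⟨C, hC⟩ := exists_norm_const_mul_qPoch_le (norm_sq_lt_one hq)
    (qPochInf (q ^ 2) (q ^ 2)) q
  refine sptCrank_expansion hq hz hpole (fun n => n)
    (fun n => (-1) ^ n * (qPochInf (q ^ 2) (q ^ 2) * qPoch q (q ^ 2) n)) (fun n => le_rfl)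
    ⟨C, fun n => by simpa using hC n⟩ (fun n => ?_) fun i => ?_
  · rw [numE2, ← qPochInf_even_mul_qPoch_two_mul hq]
    ring
  · have h : ∀ m, q ^ (m + i) * ((-1) ^ (m + i) *
          (qPochInf (q ^ 2) (q ^ 2) * qPoch q (q ^ 2) (m + i))) /
          (qPoch q q m * qPoch q q (m + (2 * i + 1)))
        = (-q) ^ m * qPoch q (q ^ 2) (m + i) / (qPoch q q m * qPoch q q (m + (2 * i + 1))) *
          ((-1) ^ i * q ^ i * qPochInf (q ^ 2) (q ^ 2)) := fun m => by
      rw [neg_pow q m]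
      ring
    have h1 := tsum_neg_pow_mul_qPoch_odd_div hq i
    have h2 : (-1 : ℂ) ^ i * (-1) ^ i = 1 := by rw [← mul_pow]; simp
    simp only [h, tsum_mul_right]
    rw [← qPochInf_mul_neg hq, pow_choose_two_succ]
    rw [eq_div_iff (mul_ne_zero h0 h0')] at h1
    linear_combination (-1) ^ i * (-1) ^ i * q ^ i.choose 2 * q ^ i * h1
      + q ^ i.choose 2 * q ^ i * qPochInf q (q ^ 2) * h2

theorem sptE4_expansion (hq : ‖q‖ < 1) (hz : z ≠ 0)
    (hpole : ∀ n : ℕ, 1 ≤ n → z * q ^ n ≠ 1 ∧ z⁻¹ * q ^ n ≠ 1) :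
    (Summable fun n : ℕ+ => sptCrankTerm (numE4 q) z q n) ∧
      HasSum (fun i : ℕ => zFactor z ((i : ℤ) + 1) * ((-1) ^ i * q ^ (i.choose 2 + 2 * i) *
          (qTheta (q * q ^ (2 * i + 1)) (q ^ 2)
            - q * qTheta (q ^ 3 * q ^ (2 * i + 1)) (q ^ 2)) / qPochInf q q))
        (sptPrefactor z q * sptE4 z q) := by
  have h0 := qPochInf_ne_zero_of_norm_lt hq hq
  refine sptCrank_expansion hq hz hpole (fun n => 2 * n)
    (fun n => qPochInf (q ^ 2) (q ^ 2) * qPoch q (q ^ 2) n) (fun n => by omega)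
    (exists_norm_const_mul_qPoch_le (norm_sq_lt_one hq) _ _) (fun n => ?_) fun i => ?_
  · rw [numE4, ← qPochInf_even_mul_qPoch_two_mul hq]
    ring
  · have h : ∀ m, q ^ (2 * (m + i)) * (qPochInf (q ^ 2) (q ^ 2) * qPoch q (q ^ 2) (m + i)) /
          (qPoch q q m * qPoch q q (m + (2 * i + 1)))
        = q ^ (2 * m) * qPoch q (q ^ 2) (m + i) /
          (qPoch q q m * qPoch q q (m + (2 * i + 1))) *
          (q ^ (2 * i) * qPochInf (q ^ 2) (q ^ 2)) := fun m => by ring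
    have h1 := tsum_pow_two_mul_mul_qPoch_odd_div hq i
    have h2 := qPochInf_neg_mul_odd hq
    simp only [h, tsum_mul_right]
    rw [← qPochInf_mul_neg hq, pow_add q (i.choose 2)]
    generalize qTheta (q * q ^ (2 * i + 1)) (q ^ 2) = s at h1 ⊢
    generalize qTheta (q ^ 3 * q ^ (2 * i + 1)) (q ^ 2) = t at h1 ⊢
    generalize qPochInf (-q) q = u at h2 ⊢
    generalize qPochInf q (q ^ 2) = v at h1 h2 ⊢
    generalize qPochInf q q = w at h0 h1 ⊢
    have h3 : (s - q * t) / w = w * u * (v / w ^ 2 * (s - q * t)) := by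
      field_simp
      linear_combination (-(s - q * t)) * h2
    rw [mul_div_assoc, h3]
    linear_combination (-1) ^ i * q ^ i.choose 2 * q ^ (2 * i) * w * u * h1

end Expansions

/-! ### The eight identities in their final form. -/

section Statements

variable {q z : ℂ}

theorem half_mul_pred (i : ℕ) : ((i : ℤ) + 1) * ((i : ℤ) + 1 - 1) / 2 = ((i + 1).choose 2 : ℕ) := by
  refine ediv_two_of_eq ?_
  rw [two_mul_choose_two]
  push_cast
  ring

theorem half_mul_succ (i : ℕ) :
    ((i : ℤ) + 1) * ((i : ℤ) + 1 + 1) / 2 = i.choose 2 + 2 * i + 1 :=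
  ediv_two_of_eq (by linear_combination -two_mul_choose_two i)

theorem half_mul_sub_three (n : ℕ) : (n : ℤ) * ((n : ℤ) - 3) / 2 = n.choose 2 - n :=
  ediv_two_of_eq (by linear_combination -two_mul_choose_two n)

theorem half_mul_three_mul_sub_one (n : ℕ) :
    (n : ℤ) * (3 * (n : ℤ) - 1) / 2 = 3 * n.choose 2 + n :=
  ediv_two_of_eq (by linear_combination -3 * two_mul_choose_two n)

theorem neg_one_zpow_eq_pow {e : ℤ} {n : ℕ} (h : e = n) : (-1 : ℂ) ^ e = (-1) ^ n :=
  zpow_eq_pow_of_eq _ h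

theorem norm_mul_pow_le_pow (hq : ‖q‖ < 1) {a : ℂ} (ha : ‖a‖ ≤ 1) {e i : ℕ}
    (he : i ≤ e) : ‖a * q ^ e‖ ≤ ‖q‖ ^ i := by
  rw [norm_mul, norm_pow]
  exact (mul_le_of_le_one_left (by positivity) ha).trans
    (pow_le_pow_of_le_one (norm_nonneg _) hq.le he)

theorem norm_one_sub_pow_le (hq : ‖q‖ < 1) (n : ℕ) : ‖1 - q ^ n‖ ≤ 2 := by
  refine (norm_sub_le _ _).trans ?_
  rw [norm_one, norm_pow]
  linarith [pow_le_one₀ (n := n) (norm_nonneg q) hq.le]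

/-- Assembling a double series with coefficients `zFactor z (i + 1)` from its rows. -/
theorem hasSum_prod_zFactor (hq : ‖q‖ < 1) (hz : z ≠ 0) {u : ℕ → ℂ} {v : ℕ → ℕ → ℂ} {V : ℕ → ℂ}
    {s : ℂ} {C : ℝ} (hu : ∀ i, ‖u i‖ ≤ C * ‖q‖ ^ i.choose 2)
    (hv : ∀ i n, ‖v i n‖ ≤ 2 * ‖q‖ ^ n.choose 2) (hrow : ∀ i, HasSum (v i) (V i))
    (h : HasSum (fun i : ℕ => zFactor z ((i : ℤ) + 1) * (u i * V i)) s) :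
    HasSum (fun p : ℕ × ℕ => zFactor z ((p.1 : ℤ) + 1) * u p.1 * v p.1 p.2) s := by
  have hC : 0 ≤ C := by simpa using (norm_nonneg _).trans (hu 0)
  refine hasSum_prod_of_rows (u := fun i : ℕ => zFactor z ((i : ℤ) + 1) * u i)
    ((summable_pow_choose_two_mul_zFactor hq hz).mul_left C)
    ((summable_pow_choose_two (norm_nonneg q) hq).mul_left 2) (fun _ => by positivity)
    (fun _ => by positivity) (fun i n => ?_) hrow (by simpa only [mul_assoc] using h)
  rw [norm_mul, norm_mul]
  calc _ ≤ ‖zFactor z ((i : ℤ) + 1)‖ * (C * ‖q‖ ^ i.choose 2) * (2 * ‖q‖ ^ n.choose 2) := by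
        gcongr
        · exact hu i
        · exact hv i n
    _ = _ := by ring

theorem sptA1_identity (hq : ‖q‖ < 1) (hz : z ≠ 0)
    (hpole : ∀ n : ℕ, 1 ≤ n → z * q ^ n ≠ 1 ∧ z⁻¹ * q ^ n ≠ 1) :
    ∃ (g : ℕ+ → ℂ) (s : ℂ),
      (∀ k : ℕ+, HasSum (fun n : ℕ+ => (-1) ^ ((n : ℤ) + (k : ℤ) + 1) *
          q ^ ((k : ℤ) * ((k : ℤ) - 1) / 2 + (n : ℤ) * ((n : ℤ) - 3) / 2 + 2 * (k : ℤ) * (n : ℤ)) *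
          (1 + q ^ (n : ℤ))) (g k)) ∧
      HasSum (fun k : ℕ+ => zFactor z k *
          ((-1) ^ ((k : ℤ) + 1) * q ^ ((k : ℤ) * ((k : ℤ) - 1) / 2) + g k)) s ∧
      sptPrefactor z q * sptA1 z q = 1 / qPochInf q q * s := by
  have h0 := qPochInf_ne_zero_of_norm_lt hq hq
  -- The inner sum is taken from `one_sub_mul_qTheta` at `x = q^(2k-1)`; its `-1` is compensated by
  -- the separate first term in the summand for `k`.
  refine ⟨fun k => (-1) ^ k.natPred * q ^ (k.natPred + 1).choose 2 *
      ((1 - q ^ (2 * k.natPred + 1)) * qTheta (q * q ^ (2 * k.natPred + 1)) q - 1),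
    qPochInf q q * (sptPrefactor z q * sptA1 z q), fun k => ?_, ?_, by field_simp⟩
  · obtain ⟨i, rfl⟩ := Equiv.pnatEquivNat.symm.surjective k
    simp only [Equiv.pnatEquivNat_symm_apply, Nat.natPred_succPNat]
    refine hasSum_pnat_of_hasSum
      ((one_sub_mul_qTheta hq (q ^ (2 * i + 1))).mul_left ((-1) ^ i * q ^ (i + 1).choose 2))
      fun j => ?_
    have e1 : ((j.succPNat : ℕ+) : ℤ) + ((i.succPNat : ℕ+) : ℤ) + 1 = (i + (j + 1) + 2 : ℕ) := by
      simp only [Nat.succPNat_coe]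
      push_cast
      ring
    have e2 : (((i.succPNat : ℕ+) : ℤ) * (((i.succPNat : ℕ+) : ℤ) - 1) / 2
        + ((j.succPNat : ℕ+) : ℤ) * (((j.succPNat : ℕ+) : ℤ) - 3) / 2
        + 2 * ((i.succPNat : ℕ+) : ℤ) * ((j.succPNat : ℕ+) : ℤ))
        = ((i + 1).choose 2 + (j + 1).choose 2 + (2 * i + 1) * (j + 1) : ℕ) := by
      rw [Nat.succPNat_coe, Nat.succPNat_coe, half_mul_sub_three]
      simp only [Nat.succ_eq_add_one, Nat.cast_add, Nat.cast_one]
      rw [half_mul_pred]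
      push_cast
      ring
    rw [neg_one_zpow_eq_pow e1, zpow_eq_pow_of_eq q e2, zpow_natCast, Nat.succPNat_coe,
      Nat.succ_eq_add_one]
    ring
  · refine hasSum_pnat_of_hasSum
      ((sptA1_expansion hq hz hpole).2.mul_left (qPochInf q q)) fun i => ?_
    have e1 : ((i.succPNat : ℕ+) : ℤ) = (i : ℤ) + 1 := by simp
    simp only [e1, half_mul_pred, zpow_natCast, Nat.natPred_succPNat]
    rw [neg_one_zpow_eq_pow (n := i + 2) (by push_cast; ring)]
    field_simp
    ring

theorem sptA3_identity (hq : ‖q‖ < 1) (hz : z ≠ 0)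
    (hpole : ∀ n : ℕ, 1 ≤ n → z * q ^ n ≠ 1 ∧ z⁻¹ * q ^ n ≠ 1) :
    ∃ s : ℂ,
      HasSum (fun p : ℕ+ × ℕ =>
          let k : ℤ := p.1
          let n : ℤ := p.2
          zFactor z k * (-1) ^ (n + k + 1) *
            q ^ (k * (k + 1) / 2 + n * (n - 3) / 2 + 2 * k * n - 1) * (1 - q ^ (2 * n + 1))) s ∧
      sptPrefactor z q * sptA3 z q = 1 / qPochInf q q * s := by
  have h0 := qPochInf_ne_zero_of_norm_lt hq hq
  refine ⟨qPochInf q q * (sptPrefactor z q * sptA3 z q), ?_, by field_simp⟩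
  have h := hasSum_prod_zFactor hq hz (u := fun i => (-1) ^ i * q ^ (i.choose 2 + 2 * i)) (C := 1)
    (fun i => by
      rw [one_mul]
      exact norm_mul_pow_le_pow hq (by simp) (Nat.le_add_right _ _))
    (v := fun i n => (-1) ^ n * q ^ n.choose 2 * (q ^ (2 * i + 1)) ^ n * (1 - q ^ (2 * n + 1)))
    (fun i n => by
      rw [mul_comm, norm_mul, ← pow_mul, mul_assoc, ← pow_add]
      exact mul_le_mul (norm_one_sub_pow_le hq _)
        (norm_mul_pow_le_pow hq (by simp) (Nat.le_add_right _ _)) (norm_nonneg _)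
        zero_le_two)
    (fun i => one_sub_mul_qTheta_sub hq (q ^ (2 * i + 1)))
    (hasSum_of_eq ((sptA3_expansion hq hz hpole).2.mul_left (qPochInf q q))
      (fun i => by field_simp) rfl)
  refine hasSum_pnat_prod_of_hasSum h fun i n => ?_
  have e1 : ((i.succPNat : ℕ+) : ℤ) = (i : ℤ) + 1 := by simp
  simp only [e1, half_mul_succ, half_mul_sub_three]
  rw [neg_one_zpow_eq_pow (n := i + n + 2) (by push_cast; ring),
    zpow_eq_pow_of_eq q (n := i.choose 2 + 2 * i + n.choose 2 + (2 * i + 1) * n)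
      (by push_cast; ring), zpow_eq_pow_of_eq q (n := 2 * n + 1) (by push_cast; ring)]
  ring

theorem sptC1_identity (hq : ‖q‖ < 1) (hz : z ≠ 0)
    (hpole : ∀ n : ℕ, 1 ≤ n → z * q ^ n ≠ 1 ∧ z⁻¹ * q ^ n ≠ 1) :
    ∃ s : ℂ,
      HasSum (fun p : ℕ+ × ℕ =>
          let k : ℤ := p.1
          let n : ℤ := p.2
          zFactor z k * (-1) ^ (k + 1) *
            q ^ (k * (k - 1) / 2 + n * (3 * n - 1) / 2 + 3 * k * n) *
            (1 - q ^ (2 * k - 1)) * (1 - q ^ (k + n))) s ∧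
      sptPrefactor z q * sptC1 z q = 1 / qPochInf q q * s := by
  have h0 := qPochInf_ne_zero_of_norm_lt hq hq
  refine ⟨qPochInf q q * (sptPrefactor z q * sptC1 z q), ?_, by field_simp⟩
  have h := hasSum_prod_zFactor hq hz
    (u := fun i => (-1) ^ i * q ^ (i + 1).choose 2 * (1 - q ^ (2 * i + 1))) (C := 2)
    (fun i => by
      rw [mul_comm, norm_mul]
      exact mul_le_mul (norm_one_sub_pow_le hq _)
        (norm_mul_pow_le_pow hq (by simp) (Nat.choose_le_succ _ _)) (norm_nonneg _)
        zero_le_two)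
    (v := fun i n => q ^ (3 * n.choose 2 + n) * (q ^ (i + 1)) ^ (3 * n) *
      (1 - q ^ (i + 1) * q ^ n))
    (fun i n => by
      rw [mul_comm, norm_mul, ← pow_mul, ← pow_add, ← pow_add, ← one_mul (q ^ (3 * _ + _ + _))]
      exact mul_le_mul (norm_one_sub_pow_le hq _)
        (norm_mul_pow_le_pow hq (by simp) (by omega)) (norm_nonneg _)
        zero_le_two)
    (fun i => hasSum_cubic_qTheta hq (q ^ (i + 1)))
    (hasSum_of_eq ((sptC1_expansion hq hz hpole).2.mul_left (qPochInf q q))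
      (fun i => by
        rw [← mul_assoc _ (zFactor _ _), mul_comm _ (zFactor _ _), mul_assoc (zFactor _ _),
          mul_div_cancel₀ _ h0]) rfl)
  refine hasSum_pnat_prod_of_hasSum h fun i n => ?_
  have e1 : ((i.succPNat : ℕ+) : ℤ) = (i : ℤ) + 1 := by simp
  simp only [e1, half_mul_pred, half_mul_three_mul_sub_one]
  rw [neg_one_zpow_eq_pow (n := i + 2) (by push_cast; ring),
    zpow_eq_pow_of_eq q (n := (i + 1).choose 2 + (3 * n.choose 2 + n) + (i + 1) * (3 * n))
      (by push_cast; ring), zpow_eq_pow_of_eq q (n := 2 * i + 1) (by push_cast; ring),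
    zpow_eq_pow_of_eq q (n := i + 1 + n) (by push_cast; ring)]
  ring

theorem sptE4_identity (hq : ‖q‖ < 1) (hz : z ≠ 0)
    (hpole : ∀ n : ℕ, 1 ≤ n → z * q ^ n ≠ 1 ∧ z⁻¹ * q ^ n ≠ 1) :
    ∃ s : ℂ,
      HasSum (fun p : ℕ+ × ℕ =>
          let k : ℤ := p.1
          let n : ℤ := p.2
          zFactor z k * (-1) ^ (k + n + 1) *
            q ^ (k * (k + 1) / 2 + n ^ 2 - n + 2 * k * n - 1) * (1 - q ^ (2 * n + 1))) s ∧
      sptPrefactor z q * sptE4 z q = 1 / qPochInf q q * s := by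
  have h0 := qPochInf_ne_zero_of_norm_lt hq hq
  refine ⟨qPochInf q q * (sptPrefactor z q * sptE4 z q), ?_, by field_simp⟩
  have h := hasSum_prod_zFactor hq hz (u := fun i => (-1) ^ i * q ^ (i.choose 2 + 2 * i)) (C := 1)
    (fun i => by
      rw [one_mul]
      exact norm_mul_pow_le_pow hq (by simp) (Nat.le_add_right _ _))
    (v := fun i n => (-1) ^ n * q ^ (2 * n.choose 2 + n) * (q ^ (2 * i + 1)) ^ n *
      (1 - q ^ (2 * n + 1)))
    (fun i n => by
      rw [mul_comm, norm_mul, ← pow_mul, mul_assoc, ← pow_add]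
      exact mul_le_mul (norm_one_sub_pow_le hq _)
        (norm_mul_pow_le_pow hq (by simp) (by omega)) (norm_nonneg _)
        zero_le_two)
    (fun i => hasSum_quadratic_qTheta hq (q ^ (2 * i + 1)))
    (hasSum_of_eq ((sptE4_expansion hq hz hpole).2.mul_left (qPochInf q q))
      (fun i => by
        rw [← mul_assoc _ (zFactor _ _), mul_comm _ (zFactor _ _), mul_assoc (zFactor _ _),
          mul_div_cancel₀ _ h0]) rfl)
  refine hasSum_pnat_prod_of_hasSum h fun i n => ?_
  have e1 : ((i.succPNat : ℕ+) : ℤ) = (i : ℤ) + 1 := by simp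
  simp only [e1, half_mul_succ]
  rw [neg_one_zpow_eq_pow (n := i + n + 2) (by push_cast; ring),
    zpow_eq_pow_of_eq q (n := i.choose 2 + 2 * i + (2 * n.choose 2 + n) + (2 * i + 1) * n)
      (by
        push_cast
        linear_combination -two_mul_choose_two n),
    zpow_eq_pow_of_eq q (n := 2 * n + 1) (by push_cast; ring)]
  ring

theorem sptE2_identity (hq : ‖q‖ < 1) (hz : z ≠ 0)
    (hpole : ∀ n : ℕ, 1 ≤ n → z * q ^ n ≠ 1 ∧ z⁻¹ * q ^ n ≠ 1) :
    ∃ s : ℂ,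
      HasSum (fun k : ℕ+ => zFactor z k * q ^ ((k : ℤ) * ((k : ℤ) - 1) / 2)) s ∧
      sptPrefactor z q * sptE2 z q = qPochInf q (q ^ 2) * s := by
  have h0 : qPochInf q (q ^ 2) ≠ 0 := qPochInf_ne_zero_of_norm_lt (norm_sq_lt_one hq) hq
  refine ⟨(qPochInf q (q ^ 2))⁻¹ * (sptPrefactor z q * sptE2 z q), ?_, by field_simp⟩
  refine hasSum_pnat_of_hasSum
    ((sptE2_expansion hq hz hpole).2.mul_left (qPochInf q (q ^ 2))⁻¹) fun i => ?_
  have e1 : ((i.succPNat : ℕ+) : ℤ) = (i : ℤ) + 1 := by simp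
  rw [e1, half_mul_pred, zpow_natCast]
  field_simp

theorem sptA5_identity (hq : ‖q‖ < 1) (hz : z ≠ 0)
    (hpole : ∀ n : ℕ, 1 ≤ n → z * q ^ n ≠ 1 ∧ z⁻¹ * q ^ n ≠ 1) :
    HasSum (fun k : ℤ => (-1) ^ k * (1 - z ^ k) * (1 - z ^ (k + 1)) * z ^ (-k) *
        q ^ (k * (3 * k + 1) / 2)) (sptPrefactor z q * sptA5 z q) := by
  have hF : ∀ k : ℤ, (-1) ^ k * (1 - z ^ k) * (1 - z ^ (k + 1)) * z ^ (-k)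
      = zFactor z (k + 1) * (-1) ^ k := fun k => by
    rw [zFactor, add_sub_cancel_right, show 1 - (k + 1) = -k by ring]
    ring
  simp only [hF]
  -- The two parts of `1 - q^(2i+1)` become the terms `k = i` and `k = -(i+1)`, which share the same
  -- `zFactor` by reflection.
  refine hasSum_int_of_hasSum_add
    (f := fun i => zFactor z ((i : ℤ) + 1) * ((-1) ^ i * q ^ (3 * i.choose 2 + 2 * i)))
    (g := fun i => zFactor z ((i : ℤ) + 1) * ((-1) ^ (i + 1) * q ^ (3 * i.choose 2 + 4 * i + 1)))
    (hasSum_of_eq (sptA5_expansion hq hz hpole).2 (fun i => by ring) rfl)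
    (summable_zFactor_mul hq hz (by simp) fun i => by omega)
    (summable_zFactor_mul hq hz (by simp) fun i => by omega) (fun i => ?_) (fun i => ?_)
  · rw [zpow_natCast, ediv_two_of_eq (b := (3 * i.choose 2 + 2 * i : ℕ)) (by
      push_cast
      linear_combination -3 * two_mul_choose_two i), zpow_natCast]
    ring
  · rw [ediv_two_of_eq (b := (3 * i.choose 2 + 4 * i + 1 : ℕ)) (by
      push_cast
      linear_combination -3 * two_mul_choose_two i), zpow_natCast,
      show -((i : ℤ) + 1) + 1 = -i by ring, zFactor_neg hz, zpow_neg, ← inv_zpow, inv_neg_one,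
      neg_one_zpow_eq_pow (n := i + 1) (by push_cast; ring)]
    ring

theorem sptA7_identity (hq : ‖q‖ < 1) (hz : z ≠ 0)
    (hpole : ∀ n : ℕ, 1 ≤ n → z * q ^ n ≠ 1 ∧ z⁻¹ * q ^ n ≠ 1) :
    HasSum (fun k : ℤ => (-1) ^ k * (1 - z ^ k) * (1 - z ^ (k + 1)) * z ^ (-k) *
        q ^ (k * (3 * k - 1) / 2)) (sptPrefactor z q * sptA7 z q) := by
  have hF : ∀ k : ℤ, (-1) ^ k * (1 - z ^ k) * (1 - z ^ (k + 1)) * z ^ (-k)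
      = zFactor z (k + 1) * (-1) ^ k := fun k => by
    rw [zFactor, add_sub_cancel_right, show 1 - (k + 1) = -k by ring]
    ring
  simp only [hF]
  refine hasSum_int_of_hasSum_add
    (f := fun i => zFactor z ((i : ℤ) + 1) * ((-1) ^ i * q ^ (3 * i.choose 2 + i)))
    (g := fun i => zFactor z ((i : ℤ) + 1) * ((-1) ^ (i + 1) * q ^ (3 * i.choose 2 + 5 * i + 2)))
    (hasSum_of_eq (sptA7_expansion hq hz hpole).2 (fun i => by ring) rfl)
    (summable_zFactor_mul hq hz (by simp) fun i => by omega)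
    (summable_zFactor_mul hq hz (by simp) fun i => by omega) (fun i => ?_) (fun i => ?_)
  · rw [zpow_natCast, ediv_two_of_eq (b := (3 * i.choose 2 + i : ℕ)) (by
      push_cast
      linear_combination -3 * two_mul_choose_two i), zpow_natCast]
    ring
  · rw [ediv_two_of_eq (b := (3 * i.choose 2 + 5 * i + 2 : ℕ)) (by
      push_cast
      linear_combination -3 * two_mul_choose_two i), zpow_natCast,
      show -((i : ℤ) + 1) + 1 = -i by ring, zFactor_neg hz, zpow_neg, ← inv_zpow, inv_neg_one,
      neg_one_zpow_eq_pow (n := i + 1) (by push_cast; ring)]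
    ring

theorem sptC5_identity (hq : ‖q‖ < 1) (hz : z ≠ 0)
    (hpole : ∀ n : ℕ, 1 ≤ n → z * q ^ n ≠ 1 ∧ z⁻¹ * q ^ n ≠ 1) :
    HasSum (fun k : ℤ => zFactor z k * (-1) ^ k * q ^ (k ^ 2))
      (sptPrefactor z q * sptC5 z q) := by
  -- After negation the halves are `k = -i` and `k = i + 1`, exactly the pairs exchanged by the
  -- symmetry of `zFactor`.
  rw [← (Equiv.neg ℤ).hasSum_iff]
  refine hasSum_int_of_hasSum_add
    (f := fun i => zFactor z ((i : ℤ) + 1) * ((-1) ^ i * q ^ i ^ 2))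
    (g := fun i => zFactor z ((i : ℤ) + 1) * ((-1) ^ (i + 1) * q ^ (i + 1) ^ 2))
    (hasSum_of_eq (sptC5_expansion hq hz hpole).2 (fun i => by ring) rfl)
    (summable_zFactor_mul hq hz (by simp) fun i => by
      rw [sq_eq_two_mul_choose_two_add]
      omega)
    (summable_zFactor_mul hq hz (by simp) fun i => by
      rw [add_sq, sq_eq_two_mul_choose_two_add]
      omega) (fun i => ?_) (fun i => ?_)
  · rw [Function.comp_apply, Equiv.neg_apply, zFactor_neg hz, zpow_neg, ← inv_zpow, inv_neg_one,
      zpow_natCast, zpow_eq_pow_of_eq q (n := i ^ 2) (by push_cast; ring)]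
    ring
  · rw [Function.comp_apply, Equiv.neg_apply, neg_neg,
      neg_one_zpow_eq_pow (n := i + 1) (by push_cast; ring),
      zpow_eq_pow_of_eq q (n := (i + 1) ^ 2) (by push_cast; ring)]
    ring

end Statements

end

/-- All exponents of `q` below are nonnegative integers: the integer divisions by `2` are exact. -/
theorem theorem2p2 (z q : ℂ) (hq : ‖q‖ < 1) (hz : z ≠ 0)
    (hpole : ∀ n : ℕ, 1 ≤ n → z * q ^ n ≠ 1 ∧ z⁻¹ * q ^ n ≠ 1) :
    -- the series defining the eight functions converge
    ((Summable fun n : ℕ+ => sptCrankTerm (numA1 q) z q n) ∧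
      (Summable fun n : ℕ+ => sptCrankTerm (numA3 q) z q n) ∧
      (Summable fun n : ℕ+ => sptCrankTerm (numA5 q) z q n) ∧
      (Summable fun n : ℕ+ => sptCrankTerm (numA7 q) z q n) ∧
      (Summable fun n : ℕ+ => sptCrankTerm (numC1 q) z q n) ∧
      (Summable fun n : ℕ+ => sptCrankTerm (numC5 q) z q n) ∧
      (Summable fun n : ℕ+ => sptCrankTerm (numE2 q) z q n) ∧
      (Summable fun n : ℕ+ => sptCrankTerm (numE4 q) z q n)) ∧
    -- A1
    (∃ (g : ℕ+ → ℂ) (s : ℂ),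
      (∀ k : ℕ+, HasSum (fun n : ℕ+ => (-1) ^ ((n : ℤ) + (k : ℤ) + 1) *
          q ^ ((k : ℤ) * ((k : ℤ) - 1) / 2 + (n : ℤ) * ((n : ℤ) - 3) / 2 + 2 * (k : ℤ) * (n : ℤ)) *
          (1 + q ^ (n : ℤ))) (g k)) ∧
      HasSum (fun k : ℕ+ => zFactor z k *
          ((-1) ^ ((k : ℤ) + 1) * q ^ ((k : ℤ) * ((k : ℤ) - 1) / 2) + g k)) s ∧
      sptPrefactor z q * sptA1 z q = 1 / qPochInf q q * s) ∧
    -- A3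
    (∃ s : ℂ,
      HasSum (fun p : ℕ+ × ℕ =>
          let k : ℤ := p.1
          let n : ℤ := p.2
          zFactor z k * (-1) ^ (n + k + 1) *
            q ^ (k * (k + 1) / 2 + n * (n - 3) / 2 + 2 * k * n - 1) * (1 - q ^ (2 * n + 1))) s ∧
      sptPrefactor z q * sptA3 z q = 1 / qPochInf q q * s) ∧
    -- A5
    HasSum (fun k : ℤ => (-1) ^ k * (1 - z ^ k) * (1 - z ^ (k + 1)) * z ^ (-k) *
        q ^ (k * (3 * k + 1) / 2))
      (sptPrefactor z q * sptA5 z q) ∧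
    -- A7
    HasSum (fun k : ℤ => (-1) ^ k * (1 - z ^ k) * (1 - z ^ (k + 1)) * z ^ (-k) *
        q ^ (k * (3 * k - 1) / 2))
      (sptPrefactor z q * sptA7 z q) ∧
    -- C1
    (∃ s : ℂ,
      HasSum (fun p : ℕ+ × ℕ =>
          let k : ℤ := p.1
          let n : ℤ := p.2
          zFactor z k * (-1) ^ (k + 1) *
            q ^ (k * (k - 1) / 2 + n * (3 * n - 1) / 2 + 3 * k * n) *
            (1 - q ^ (2 * k - 1)) * (1 - q ^ (k + n))) s ∧
      sptPrefactor z q * sptC1 z q = 1 / qPochInf q q * s) ∧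
    -- C5
    HasSum (fun k : ℤ => zFactor z k * (-1) ^ k * q ^ (k ^ 2))
      (sptPrefactor z q * sptC5 z q) ∧
    -- E2
    (∃ s : ℂ,
      HasSum (fun k : ℕ+ => zFactor z k * q ^ ((k : ℤ) * ((k : ℤ) - 1) / 2)) s ∧
      sptPrefactor z q * sptE2 z q = qPochInf q (q ^ 2) * s) ∧
    -- E4
    (∃ s : ℂ,
      HasSum (fun p : ℕ+ × ℕ =>
          let k : ℤ := p.1
          let n : ℤ := p.2
          zFactor z k * (-1) ^ (k + n + 1) *
            q ^ (k * (k + 1) / 2 + n ^ 2 - n + 2 * k * n - 1) * (1 - q ^ (2 * n + 1))) s ∧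
      sptPrefactor z q * sptE4 z q = 1 / qPochInf q q * s) := by
  have hA1 := (sptA1_expansion hq hz hpole).1
  have hA3 := (sptA3_expansion hq hz hpole).1
  have hA5 := (sptA5_expansion hq hz hpole).1
  have hA7 := (sptA7_expansion hq hz hpole).1
  have hC1 := (sptC1_expansion hq hz hpole).1
  have hC5 := (sptC5_expansion hq hz hpole).1
  have hE2 := (sptE2_expansion hq hz hpole).1
  have hE4 := (sptE4_expansion hq hz hpole).1
  exact ⟨⟨hA1, hA3, hA5, hA7, hC1, hC5, hE2, hE4⟩, sptA1_identity hq hz hpole,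
    sptA3_identity hq hz hpole, sptA5_identity hq hz hpole, sptA7_identity hq hz hpole,
    sptC1_identity hq hz hpole, sptC5_identity hq hz hpole, sptE2_identity hq hz hpole,
    sptE4_identity hq hz hpole⟩
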